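/- A two-sided platform has a finite set $\mathcal C$ of customers and a finite set $\mathcal S$ of suppliers. Each agent $a$ has a choice model $\phi_a$: when an assortment $A$ of agents of the opposite side is displayed to $a$, it chooses the alternative $b\in A$ with probability $\phi_a(b,A)$ and the outside option with probability $\phi_a(0,A)=1-\sum_{b\in A}\phi_a(b,A)$. The demand function $f_a(A)=\sum_{b\in A}\phi_a(b,A)$ of every agent is assumed to be monotone and submodular. A (possibly randomized) policy processes the agents in steps. In each step it selects a set of agents that have not yet been processed, displays an assortment to each of them, and observes their independent choices, until every agent has been processed. A match is a pair of a customer and a supplier who choose each other, and the objective is the expected total number of matches. A one-sided policy completely processes one side (the initiating side, which may be either side, but is fixed by the policy) before processing the other one (the responding side). It is static if it processes all agents of the initiating side simultaneously, and adaptive if it processes them one at a time, observing each choice. On the responding side, either (a) an agent is shown only agents that chose it, or (b) any agents may be shown to it; in case (b) the choice models are moreover assumed to be weakly substitutable, that is, $\phi_a(b,A')\le\phi_a(b,A)$ whenever $A\subseteq A'$ and $b\in A\cup\{0\}$. Each agent $a$ has a positive integer $K_a$. In the two-way constrained setting every assortment displayed to any agent $a$ has at most $K_a$ elements; in the one-way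 constrained setting this is required only of the agents of the initiating side, and the responding side is unconstrained. Let $\mathrm{OPT}_{\mathsf{OS}}(I)$ and $\mathrm{OPT}_{\mathsf{OA}}(I)$ be the optimal values over all one-sided static, respectively all one-sided adaptive, policies (with either initiating side) for an instance $I$, which consists of $\mathcal C$, $\mathcal S$, the choice models and the numbers $K_a$. Let the adaptivity gap be $\sup_I \mathrm{OPT}_{\mathsf{OA}}(I)/\mathrm{OPT}_{\mathsf{OS}}(I)$ (instances where both values are $0$ are disregarded). Then in each of the cases (a) and (b): 1. In the two-way constrained setting, the adaptivity gap is at least $\frac{e}{e-1}$ and at most $\left(\frac{e}{e-1}\right)^2$. 2. In the two-way constrained setting, if the supremum is restricted to instances in which all customers and suppliers follow multinomial logit (MNL) models, that is, $\phi_a(b,A)=v_{ab}/(1+\sum_{c\in A}v_{ac})$ for $b\in A$ with weights $v_{ab}\ge 0$, then the adaptivity gap is exactly $\frac{e}{e-1}$. (MNL models satisfy all the assumptions above, so nothing further is assumed in either case.) 3. In the one-way constrained setting, the adaptivity gap is exactly $\frac{e}{e-1}$. -/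

import Mathlib

open scoped ENNReal

noncomputable section

/-- A discrete choice model over a finite set `β` of alternatives.  `prob (some b) S` is the
probability of choosing the alternative `b`, and `prob none S` the probability of choosing the
outside option, when the assortment `S` is displayed. -/
structure ChoiceModel (β : Type) where
  prob : Option β → Finset β → ℝ
  nonneg : ∀ b S, 0 ≤ prob b S
  eq_zero_of_notMem : ∀ (S : Finset β) (b : β), b ∉ S → prob (some b) S = 0
  sum_eq_one : ∀ S : Finset β, prob none S + ∑ b ∈ S, prob (some b) S = 1

namespace ChoiceModel

variable {β : Type}

/-- The (unconstrained) demand function: the probability that some displayed alternative is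
chosen. -/
def demand (φ : ChoiceModel β) (S : Finset β) : ℝ := ∑ b ∈ S, φ.prob (some b) S

/-- The demand function is a monotone submodular set function. -/
def MonotoneSubmodular [DecidableEq β] (φ : ChoiceModel β) : Prop :=
  (∀ E E' : Finset β, E ⊆ E' → φ.demand E ≤ φ.demand E') ∧
  (∀ (E E' : Finset β) (e : β), E ⊆ E' → e ∉ E' →
    φ.demand (insert e E') - φ.demand E' ≤ φ.demand (insert e E) - φ.demand E)

/-- Weak substitutability: enlarging the assortment does not increase the probability of any
option (the outside option included) that was already available. -/
def WeaklySubstitutable (φ : ChoiceModel β) : Prop :=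
  ∀ A A' : Finset β, A ⊆ A' →
    φ.prob none A' ≤ φ.prob none A ∧ ∀ a ∈ A, φ.prob (some a) A' ≤ φ.prob (some a) A

/-- Multinomial logit model, the weight of the outside option being normalized to `1`. -/
def IsMNL (φ : ChoiceModel β) : Prop :=
  ∃ v : β → ℝ, (∀ b, 0 ≤ v b) ∧
    ∀ S : Finset β, φ.prob none S = 1 / (1 + ∑ l ∈ S, v l) ∧
      ∀ b ∈ S, φ.prob (some b) S = v b / (1 + ∑ l ∈ S, v l)

end ChoiceModel

/-- Policies (finite decision trees) for a platform with customers `C` and suppliers `S`, where the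
customers in `R` and the suppliers in `T` remain to be processed.
* `finish`: nobody remains to be processed.
* `step A B showC showS next`: the agents in `A` and `B` are processed simultaneously,
  `showC i` being displayed to the customer `i ∈ A` and `showS j` to the supplier `j ∈ B`; after
  their choices have been observed the policy continues with the remaining agents.
* `mix w next`: the policy randomizes, continuing with `next l` with probability `w l`. -/
inductive Policy (C S : Type) [DecidableEq C] [DecidableEq S] : Finset C → Finset S → Type
  | finish {R : Finset C} {T : Finset S} (hR : R = ∅) (hT : T = ∅) : Policy C S R T
  | step {R : Finset C} {T : Finset S} (A : Finset C) (B : Finset S) (hA : A ⊆ R) (hB : B ⊆ T)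
      (showC : A → Finset S) (showS : B → Finset C)
      (next : (A → Option S) → (B → Option C) → Policy C S (R \ A) (T \ B)) : Policy C S R T
  | mix {R : Finset C} {T : Finset S} (k : ℕ) (w : Fin k → ℝ) (hw : ∀ l, 0 ≤ w l)
      (hsum : ∑ l, w l = 1) (next : Fin k → Policy C S R T) : Policy C S R T

/-- Choices made so far (`none` for agents not yet processed), updated by the choices `c` of the
agents in `A`. -/
def updateChoices {α β : Type} [DecidableEq α] (x : α → Option β) (A : Finset α)
    (c : A → Option β) : α → Option β :=
  fun a => if h : a ∈ A then c ⟨a, h⟩ else x a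

/-- Number of matches: pairs of a customer and a supplier who choose each other. -/
def numMatches {C S : Type} [Fintype C] [Fintype S] [DecidableEq C] [DecidableEq S]
    (x : C → Option S) (y : S → Option C) : ℕ :=
  (Finset.univ.filter fun p : C × S => x p.1 = some p.2 ∧ y p.2 = some p.1).card

/-- Which agents of the opposite side may be displayed to an agent that is processed after that
whole side has made its choices: either only agents that chose it, or any agents. -/
inductive DisplayRule
  | choosersOnly
  | anyAgents

namespace Policy

variable {C S : Type} [DecidableEq C] [DecidableEq S]

/-- Expected total number of matches of a policy, given the choices `x`, `y` observed so far;
agents that are processed simultaneously choose independently. -/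
def expectedMatchesFrom [Fintype C] [Fintype S]
    (φC : C → ChoiceModel S) (φS : S → ChoiceModel C) :
    {R : Finset C} → {T : Finset S} → Policy C S R T →
      (C → Option S) → (S → Option C) → ℝ
  | _, _, finish _ _, x, y => (numMatches x y : ℝ)
  | _, _, step A B _ _ showC showS next, x, y =>
      ∑ c : A → Option S, ∑ d : B → Option C,
        (∏ i : A, (φC i).prob (c i) (showC i)) * (∏ j : B, (φS j).prob (d j) (showS j)) *
          expectedMatchesFrom φC φS (next c d) (updateChoices x A c) (updateChoices y B d)
  | _, _, mix _ w _ _ next, x, y => ∑ l, w l * expectedMatchesFrom φC φS (next l) x y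

/-- Expected total number of matches of a policy that starts with everybody unprocessed. -/
def expectedMatches [Fintype C] [Fintype S] (φC : C → ChoiceModel S) (φS : S → ChoiceModel C)
    (π : Policy C S Finset.univ Finset.univ) : ℝ :=
  π.expectedMatchesFrom φC φS (fun _ => none) (fun _ => none)

/-- Every agent `a` is shown at most `K a` alternatives (`K a = ⊤`: no constraint). -/
def RespectsCaps (KC : C → ℕ∞) (KS : S → ℕ∞) :
    {R : Finset C} → {T : Finset S} → Policy C S R T → Prop
  | _, _, finish _ _ => True
  | _, _, step A B _ _ showC showS next =>
      (∀ i : A, ((showC i).card : ℕ∞) ≤ KC i) ∧ (∀ j : B, ((showS j).card : ℕ∞) ≤ KS j) ∧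
        ∀ c d, RespectsCaps KC KS (next c d)
  | _, _, mix _ _ _ _ next => ∀ l, RespectsCaps KC KS (next l)

/-- Once all customers have been processed, every supplier is shown only customers that chose it,
and symmetrically; `x`, `y` are the choices observed so far. -/
def ShowsChoosersOnly :
    {R : Finset C} → {T : Finset S} → Policy C S R T →
      (C → Option S) → (S → Option C) → Prop
  | _, _, finish _ _, _, _ => True
  | R, T, step A B _ _ showC showS next, x, y =>
      (R = ∅ → ∀ j : B, ∀ i ∈ showS j, x i = some (j : S)) ∧
      (T = ∅ → ∀ i : A, ∀ j ∈ showC i, y j = some (i : C)) ∧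
        ∀ c d, ShowsChoosersOnly (next c d) (updateChoices x A c) (updateChoices y B d)
  | _, _, mix _ _ _ _ next, x, y => ∀ l, ShowsChoosersOnly (next l) x y

/-- The policy obeys the given display rule. -/
def Obeys [Fintype C] [Fintype S] (rule : DisplayRule) (π : Policy C S Finset.univ Finset.univ) : Prop :=
  match rule with
  | .choosersOnly => π.ShowsChoosersOnly (fun _ => none) (fun _ => none)
  | .anyAgents => True

/-- Customers initiate: no supplier is processed while customers remain, and as long as the set `R`
of remaining customers is nonempty the processed batch `A` satisfies `batch R A`.  The suppliers
are processed afterwards, in any number of steps. -/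
def CustomersFirst (batch : ∀ {α : Type}, Finset α → Finset α → Prop) :
    {R : Finset C} → {T : Finset S} → Policy C S R T → Prop
  | _, _, finish _ _ => True
  | R, _, step A B _ _ _ _ next =>
      (R.Nonempty → batch R A ∧ B = ∅) ∧ ∀ c d, CustomersFirst batch (next c d)
  | _, _, mix _ _ _ _ next => ∀ l, CustomersFirst batch (next l)

/-- Suppliers initiate. -/
def SuppliersFirst (batch : ∀ {α : Type}, Finset α → Finset α → Prop) :
    {R : Finset C} → {T : Finset S} → Policy C S R T → Prop
  | _, _, finish _ _ => True
  | _, T, step A B _ _ _ _ next =>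
      (T.Nonempty → batch T B ∧ A = ∅) ∧ ∀ c d, SuppliersFirst batch (next c d)
  | _, _, mix _ _ _ _ next => ∀ l, SuppliersFirst batch (next l)

end Policy

/-- The initiating side is processed all at once (`isStatic`), or one agent at a time
(`isAdaptive`). -/
inductive Adaptivity
  | isStatic
  | isAdaptive

/-- The batches allowed on the initiating side: everybody, respectively exactly one agent. -/
def Adaptivity.Batch (t : Adaptivity) {α : Type} (R A : Finset α) : Prop :=
  match t with
  | .isStatic => A = R
  | .isAdaptive => A.card = 1

/-- Two-way constrained: the caps bind on both sides.  One-way constrained: the caps bind on the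
initiating side only. -/
inductive Setting
  | twoWay
  | oneWay

/-- An instance: `n` customers, `m` suppliers, their choice models, and the (positive) maximal
assortment sizes. -/
structure Instance where
  n : ℕ
  m : ℕ
  customer : Fin n → ChoiceModel (Fin m)
  supplier : Fin m → ChoiceModel (Fin n)
  capC : Fin n → ℕ+
  capS : Fin m → ℕ+

namespace Instance

variable (I : Instance)

/-- The platform policies for the instance. -/
abbrev Pol : Type := Policy (Fin I.n) (Fin I.m) Finset.univ Finset.univ

/-- The caps of the customers as elements of `ℕ∞`. -/
def KC : Fin I.n → ℕ∞ := fun i => ((I.capC i : ℕ) : ℕ∞)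

/-- The caps of the suppliers as elements of `ℕ∞`. -/
def KS : Fin I.m → ℕ∞ := fun j => ((I.capS j : ℕ) : ℕ∞)

/-- One-sided policies with initiating customers. -/
def customerPolicies (s : Setting) (rule : DisplayRule) (t : Adaptivity) : Set I.Pol :=
  {π | π.CustomersFirst t.Batch ∧ π.Obeys rule ∧
    match s with
    | .twoWay => π.RespectsCaps I.KC I.KS
    | .oneWay => π.RespectsCaps I.KC (fun _ => ⊤)}

/-- One-sided policies with initiating suppliers. -/
def supplierPolicies (s : Setting) (rule : DisplayRule) (t : Adaptivity) : Set I.Pol :=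
  {π | π.SuppliersFirst t.Batch ∧ π.Obeys rule ∧
    match s with
    | .twoWay => π.RespectsCaps I.KC I.KS
    | .oneWay => π.RespectsCaps (fun _ => ⊤) I.KS}

/-- Optimal expected number of matches among the one-sided policies (static or adaptive). -/
def OPT (s : Setting) (rule : DisplayRule) (t : Adaptivity) : ℝ≥0∞ :=
  ⨆ π ∈ I.customerPolicies s rule t ∪ I.supplierPolicies s rule t,
    ENNReal.ofReal (π.expectedMatches I.customer I.supplier)

/-- Standing assumption: all demand functions are monotone and submodular; if arbitrary agents may
be displayed to the responding side, the choice models are moreover weakly substitutable. -/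
def General (rule : DisplayRule) (I : Instance) : Prop :=
  (∀ i, (I.customer i).MonotoneSubmodular) ∧ (∀ j, (I.supplier j).MonotoneSubmodular) ∧
    (rule = DisplayRule.anyAgents →
      (∀ i, (I.customer i).WeaklySubstitutable) ∧ (∀ j, (I.supplier j).WeaklySubstitutable))

/-- All customers and suppliers follow MNL models. -/
def AllMNL (I : Instance) : Prop :=
  (∀ i, (I.customer i).IsMNL) ∧ (∀ j, (I.supplier j).IsMNL)

end Instance

/-- The adaptivity gap between one-sided static and one-sided adaptive policies over the class `P`
of instances: the supremum of the ratios of the optimal values.  In `ℝ≥0∞` the ratio `a / 0` is `∞`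
for `a ≠ 0`, and `0 / 0 = 0`, so instances where both values vanish do not count. -/
def adaptivityGap (s : Setting) (rule : DisplayRule) (P : Instance → Prop) : ℝ≥0∞ :=
  ⨆ (I : Instance) (_ : P I),
    I.OPT s rule Adaptivity.isAdaptive / I.OPT s rule Adaptivity.isStatic

end

open scoped ENNReal

noncomputable section

set_option linter.unusedSectionVars false

/-! Upper bounds. By symmetry let the customers initiate. Once they have chosen, the best response
shows each supplier its best feasible set of customers that chose it, worth `capped K f` of the set
of its choosers, where `f` is its demand; by weak substitutability, showing anybody else does not
help (`expectedMatchesFrom_le_responseValue`). An adaptive policy therefore matters only through the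
law it induces on choice profiles, and a single property of this law is needed: the marginal of each
customer is a mixture of choice distributions of feasible assortments (`exists_isLaw`). Replace the
law by the product of its marginals. For each supplier the set of choosers keeps its marginals and
becomes independent, so the loss is at most the correlation gap of `capped K f`. The value is now
linear in the distribution of each customer, so mixtures can be replaced by single assortments, one
customer at a time (`exists_staticValue_ge`). The result is a static policy.

It remains to bound correlation gaps. The factor is 1 - 1/e for monotone submodular functions
(`MonoSubmod.hasCorrelationGap`). This settles unconstrained responses, and MNL models as well,
since their capped demand is again submodular (`IsMNL.capped_monoSubmod`). In general `capped K f`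
is not submodular. Then the optimal subsets are first made independent at the cost of a factor 1 -
1/e; the resulting set has expected size at most K, and trimming it to K elements costs a further
factor 2/3 > 1 - 1/e if K ≥ 2, while K = 1 reduces to a submodular function
(`MonoSubmod.capped_hasCorrelationGap`).

Lower bound. In `gapInstance k` there are k² suppliers and k²(k+2) customers, each of whom picks a
single displayed supplier with probability 1/(k+2). For a static policy with initiating customers it
is best, by convexity, to spread the displays evenly, and then about a fraction 1/e of the suppliers
is chosen by nobody; with initiating suppliers almost no customer accepts. An adaptive policy keeps
displaying a supplier not chosen yet: the number of successes has mean k² and standard deviation at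
most k, so almost all suppliers are reached, and each accepts with probability at least k/(k+1). All
models being MNL, this one family serves all three claims. -/

/-- Expectation of `h` when the coordinates are independent with weights `q i`. -/
def prodExp {ι α : Type} [Fintype ι] [DecidableEq ι] [Fintype α] (q : ι → α → ℝ)
    (h : (ι → α) → ℝ) : ℝ :=
  ∑ c : ι → α, (∏ i, q i (c i)) * h c

/-! ### Expectations under product laws. -/

section ProdExp

variable {ι α β : Type} [Fintype ι] [DecidableEq ι] [Fintype α] [Fintype β]

theorem sum_split (k : ι) (Φ : (ι → α) → ℝ) :
    ∑ c, Φ c = ∑ a, ∑ d : {j // j ≠ k} → α, Φ ((Equiv.funSplitAt k α).symm (a, d)) := by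
  rw [← Fintype.sum_prod_type', ← (Equiv.funSplitAt k α).symm.sum_comp]

theorem prod_split (k : ι) (q : ι → α → ℝ) (a : α) (d : {j // j ≠ k} → α) :
    ∏ i, q i ((Equiv.funSplitAt k α).symm (a, d) i) = q k a * ∏ j : {j // j ≠ k}, q j (d j) := by
  rw [Fintype.prod_eq_mul_prod_subtype_ne _ k]
  congr 1
  · simp
  · refine Finset.prod_congr rfl fun j _ => ?_
    simp [j.2]

theorem update_split (k : ι) (a b : α) (d : {j // j ≠ k} → α) :
    Function.update ((Equiv.funSplitAt k α).symm (a, d)) k b =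
      (Equiv.funSplitAt k α).symm (b, d) := by
  ext i
  by_cases h : i = k
  · subst h; simp
  · simp [h]

/-- The updated integrand ignores the coordinate `k`, so the old weights there sum out to 1. The new
weights `r` are arbitrary: signed weights occur in the derivative of the multilinear extension. -/
theorem prodExp_update (q : ι → α → ℝ) (k : ι) (hq : ∑ a, q k a = 1) (r : α → ℝ)
    (h : (ι → α) → ℝ) :
    prodExp (Function.update q k r) h =
      ∑ a, r a * prodExp q (fun c => h (Function.update c k a)) := by
  unfold prodExp
  rw [sum_split k]
  refine Finset.sum_congr rfl fun a _ => ?_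
  rw [sum_split k]
  simp_rw [update_split, prod_split]
  rw [Finset.sum_comm, Finset.mul_sum]
  refine Finset.sum_congr rfl fun d _ => ?_
  rw [← Finset.sum_mul, ← Finset.sum_mul, hq]
  have : ∀ j : {j // j ≠ k}, Function.update q k r j (d j) = q j (d j) := fun j => by
    rw [Function.update_of_ne j.2]
  simp [this, mul_assoc]

theorem prodExp_cond (q : ι → α → ℝ) (k : ι) (hq : ∑ a, q k a = 1) (h : (ι → α) → ℝ) :
    prodExp q h = ∑ a, q k a * prodExp q (fun c => h (Function.update c k a)) := by
  rw [← prodExp_update q k hq, Function.update_eq_self]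

theorem sum_prod_eq_one (q : ι → α → ℝ) (hq : ∀ i, ∑ a, q i a = 1) :
    ∑ c : ι → α, ∏ i, q i (c i) = 1 := by
  rw [← Fintype.prod_sum]
  simp [hq]

theorem prodExp_const (q : ι → α → ℝ) (hq : ∀ i, ∑ a, q i a = 1) (b : ℝ) :
    prodExp q (fun _ => b) = b := by
  rw [prodExp, ← Finset.sum_mul, sum_prod_eq_one q hq, one_mul]

theorem prodExp_mono {q : ι → α → ℝ} (hq : ∀ i a, 0 ≤ q i a) {h h' : (ι → α) → ℝ}
    (hh : ∀ c, h c ≤ h' c) : prodExp q h ≤ prodExp q h' :=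
  Finset.sum_le_sum fun c _ =>
    mul_le_mul_of_nonneg_left (hh c) (Finset.prod_nonneg fun i _ => hq i (c i))

theorem prodExp_add (q : ι → α → ℝ) (h h' : (ι → α) → ℝ) :
    prodExp q (fun c => h c + h' c) = prodExp q h + prodExp q h' := by
  simp [prodExp, mul_add, Finset.sum_add_distrib]

theorem prodExp_sub (q : ι → α → ℝ) (h h' : (ι → α) → ℝ) :
    prodExp q (fun c => h c - h' c) = prodExp q h - prodExp q h' := by
  simp [prodExp, mul_sub, Finset.sum_sub_distrib]

theorem prodExp_sum {κ : Type} (s : Finset κ) (q : ι → α → ℝ) (h : κ → (ι → α) → ℝ) :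
    prodExp q (fun c => ∑ k ∈ s, h k c) = ∑ k ∈ s, prodExp q (h k) := by
  simp only [prodExp, Finset.mul_sum]
  exact Finset.sum_comm

theorem prodExp_const_mul (q : ι → α → ℝ) (b : ℝ) (h : (ι → α) → ℝ) :
    prodExp q (fun c => b * h c) = b * prodExp q h := by
  simp only [prodExp, Finset.mul_sum]
  exact Finset.sum_congr rfl fun c _ => by ring

theorem prodExp_coord (q : ι → α → ℝ) (hq : ∀ i, ∑ a, q i a = 1) (k : ι) (h : α → ℝ) :
    prodExp q (fun c => h (c k)) = ∑ a, q k a * h a := by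
  rw [prodExp_cond q k (hq k)]
  simp [prodExp_const q hq]

/-- Images of independent coordinates are independent, with pushed-forward weights. This turns
choices into the events of choosing a given supplier. -/
theorem prodExp_map [DecidableEq β] (q : ι → α → ℝ) (σ : α → β) (h : (ι → β) → ℝ) :
    prodExp q (fun c => h (fun i => σ (c i))) =
      prodExp (fun i b => ∑ a, if σ a = b then q i a else 0) h := by
  unfold prodExp
  simp_rw [Fintype.prod_sum, Finset.sum_mul]
  rw [Finset.sum_comm]
  refine Finset.sum_congr rfl fun c _ => ?_
  rw [Finset.sum_eq_single (fun i => σ (c i))]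
  · simp
  · intro b _ hb
    obtain ⟨i, hi⟩ := Function.ne_iff.1 hb
    rw [Finset.prod_eq_zero (Finset.mem_univ i), zero_mul]
    rw [if_neg (Ne.symm hi)]
  · simp

theorem prodExp_congr {q q' : ι → α → ℝ} (hq : ∀ i a, q i a = q' i a) (h : (ι → α) → ℝ) :
    prodExp q h = prodExp q' h := by
  have : q = q' := by ext i a; exact hq i a
  rw [this]

end ProdExp

/-! ### The multilinear extension and its derivative along a ray. -/

section Multilinear

variable {ι : Type} [Fintype ι] [DecidableEq ι]

/-- Bernoulli weights with success probabilities `p`. -/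
def bern (p : ι → ℝ) (i : ι) (b : Bool) : ℝ := if b then p i else 1 - p i

/-- The set of successes. -/
def successes (c : ι → Bool) : Finset ι := Finset.univ.filter fun i => c i = true

/-- Multilinear extension of a set function: the expectation of `f` at a random set containing
each `i` independently with probability `p i`. -/
def multilin (p : ι → ℝ) (f : Finset ι → ℝ) : ℝ := prodExp (bern p) fun c => f (successes c)

theorem sum_bern (p : ι → ℝ) (i : ι) : ∑ b, bern p i b = 1 := by simp [bern]

theorem bern_nonneg {p : ι → ℝ} (h0 : ∀ i, 0 ≤ p i) (h1 : ∀ i, p i ≤ 1) (i : ι) (b : Bool) :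
    0 ≤ bern p i b := by
  have := h0 i; have := h1 i
  unfold bern; split_ifs <;> linarith

theorem successes_update_true (c : ι → Bool) (k : ι) :
    successes (Function.update c k true) = insert k (successes c) := by
  ext i; by_cases h : i = k <;> simp [successes, h]

theorem successes_update_false (c : ι → Bool) (k : ι) :
    successes (Function.update c k false) = (successes c).erase k := by
  ext i; by_cases h : i = k <;> simp [successes, h]

theorem multilin_update (p : ι → ℝ) (k : ι) (x : ℝ) (f : Finset ι → ℝ) :
    multilin (Function.update p k x) f =
      x * multilin p (fun R => f (insert k R)) + (1 - x) * multilin p (fun R => f (R.erase k)) := by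
  have : bern (Function.update p k x) =
      Function.update (bern p) k (fun b => if b then x else 1 - x) := by
    ext i b
    by_cases h : i = k
    · subst h; simp [bern]
    · simp [bern, h]
  unfold multilin
  rw [this, prodExp_update _ _ (sum_bern p k)]
  simp [successes_update_true, successes_update_false]

theorem multilin_cond (p : ι → ℝ) (k : ι) (f : Finset ι → ℝ) :
    multilin p f =
      p k * multilin p (fun R => f (insert k R)) +
        (1 - p k) * multilin p (fun R => f (R.erase k)) := by
  rw [← multilin_update, Function.update_eq_self]

theorem multilin_mono {p : ι → ℝ} (h0 : ∀ i, 0 ≤ p i) (h1 : ∀ i, p i ≤ 1)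
    {f f' : Finset ι → ℝ} (h : ∀ R, f R ≤ f' R) : multilin p f ≤ multilin p f' :=
  prodExp_mono (bern_nonneg h0 h1) fun _ => h _

theorem multilin_zero (f : Finset ι → ℝ) : multilin (0 : ι → ℝ) f = f ∅ := by
  unfold multilin prodExp
  rw [Finset.sum_eq_single (fun _ => false)]
  · simp [bern, successes]
  · intro c _ hc
    obtain ⟨i, hi⟩ := Function.ne_iff.1 hc
    rw [Finset.prod_eq_zero (Finset.mem_univ i), zero_mul]
    simp only [ne_eq, Bool.not_eq_false] at hi
    simp [bern, hi]
  · simp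

theorem multilin_le_of_le {p p' : ι → ℝ} (h0 : ∀ i, 0 ≤ p i) (hp : ∀ i, p i ≤ p' i)
    (h1 : ∀ i, p' i ≤ 1) {f : Finset ι → ℝ} (hf : ∀ E E', E ⊆ E' → f E ≤ f E') :
    multilin p f ≤ multilin p' f := by
  -- The coordinates are switched from `p` to `p'` one at a time; each switch moves weight from
  -- `R.erase k` to `insert k R`.
  have key : ∀ s : Finset ι, multilin p f ≤ multilin (s.piecewise p' p) f := by
    intro s
    induction s using Finset.induction_on with
    | empty => simp
    | insert k s hk ih =>
      refine ih.trans ?_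
      set r := s.piecewise p' p with hr
      have hr0 : ∀ i, 0 ≤ r i := fun i => by
        by_cases h : i ∈ s <;> simp [hr, h, h0, (h0 i).trans (hp i)]
      have hr1 : ∀ i, r i ≤ 1 := fun i => by
        by_cases h : i ∈ s <;> simp [hr, h, h1, (hp i).trans (h1 i)]
      have hrk : r k = p k := by simp [hr, hk]
      rw [Finset.piecewise_insert, multilin_update, multilin_cond r k, hrk]
      have : multilin r (fun R => f (R.erase k)) ≤ multilin r (fun R => f (insert k R)) :=
        multilin_mono hr0 hr1 fun R =>
          hf _ _ ((Finset.erase_subset _ _).trans (Finset.subset_insert _ _))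
      nlinarith [hp k]
  simpa using key Finset.univ

/-- Product rule: the coordinate `k` contributes the expectation in which its Bernoulli weights `t *
x k`, `1 - t * x k` are replaced by their derivatives `x k`, `- x k`, and `prodExp_update` evaluates
it. -/
theorem hasDerivAt_multilin (x : ι → ℝ) (f : Finset ι → ℝ) (t : ℝ) :
    HasDerivAt (fun t : ℝ => multilin (fun i => t * x i) f)
      (∑ k, x k * (multilin (fun i => t * x i) (fun R => f (insert k R)) -
        multilin (fun i => t * x i) (fun R => f (R.erase k)))) t := by
  have hb : ∀ k (b : Bool), HasDerivAt (fun t : ℝ => bern (fun i => t * x i) k b)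
      (if b then x k else - x k) t := by
    intro k b
    cases b
    · simpa [bern] using ((hasDerivAt_id t).mul_const (x k)).const_sub 1
    · simpa [bern] using (hasDerivAt_id t).mul_const (x k)
  have key : HasDerivAt (fun t : ℝ => multilin (fun i => t * x i) f)
      (∑ c : ι → Bool, (∑ k, (∏ j ∈ Finset.univ.erase k, bern (fun i => t * x i) j (c j)) •
        (if c k then x k else - x k)) * f (successes c)) t := by
    unfold multilin prodExp
    refine HasDerivAt.fun_sum fun c _ => ?_
    exact (HasDerivAt.fun_finsetProd fun k _ => hb k (c k)).mul_const _
  convert key using 1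
  simp_rw [Finset.sum_mul]
  rw [Finset.sum_comm]
  refine Finset.sum_congr rfl fun k _ => ?_
  have h := prodExp_update (bern fun i => t * x i) k (sum_bern _ k)
    (fun b => if b then x k else - x k) (fun c => f (successes c))
  simp only [Fintype.sum_bool, successes_update_true, successes_update_false] at h
  have e : x k * (multilin (fun i => t * x i) (fun R => f (insert k R)) -
        multilin (fun i => t * x i) (fun R => f (R.erase k))) =
      prodExp (Function.update (bern fun i => t * x i) k (fun b => if b then x k else - x k))
        (fun c => f (successes c)) := by
    rw [h]; simp [multilin]; ring
  rw [e, prodExp]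
  refine Finset.sum_congr rfl fun c _ => ?_
  congr 1
  rw [← Finset.mul_prod_erase _ _ (Finset.mem_univ k), smul_eq_mul, mul_comm]
  congr 1
  · refine Finset.prod_congr rfl fun j hj => ?_
    rw [Function.update_of_ne (Finset.ne_of_mem_erase hj)]
  · simp

end Multilinear

/-! ### Monotone submodular functions and the factor 1 - 1/e. -/

section SetFunctions

variable {ι : Type} [Fintype ι] [DecidableEq ι]

/-- Monotone submodular set functions. -/
structure MonoSubmod (f : Finset ι → ℝ) : Prop where
  mono : ∀ E E', E ⊆ E' → f E ≤ f E'
  submod : ∀ (E E' : Finset ι) (e : ι), E ⊆ E' → e ∉ E' →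
    f (insert e E') - f E' ≤ f (insert e E) - f E

/-- The expectation of `g` at a random set is at most `1 / α` times its expectation at the random
set with the same marginals whose elements are included independently. -/
def HasCorrelationGap (α : ℝ) (g : Finset ι → ℝ) : Prop :=
  ∀ (Ω : Type) [Fintype Ω] (μ : Ω → ℝ) (T : Ω → Finset ι), (∀ ω, 0 ≤ μ ω) → ∑ ω, μ ω = 1 →
    α * ∑ ω, μ ω * g (T ω) ≤ multilin (fun i => ∑ ω, if i ∈ T ω then μ ω else 0) g

namespace MonoSubmod

variable {f : Finset ι → ℝ}

/-- The elements of `X` are added to `R` one by one; by submodularity each gains at most its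
marginal value at `R`. -/
theorem le_add_sum (hf : MonoSubmod f) (X R : Finset ι) :
    f X ≤ f R + ∑ i ∈ X, (f (insert i R) - f R) := by
  have key : f (R ∪ X) ≤ f R + ∑ i ∈ X, (f (insert i R) - f R) := by
    induction X using Finset.induction_on with
    | empty => simp
    | insert e X he ih =>
      rw [Finset.sum_insert he, Finset.union_insert]
      by_cases h : e ∈ R ∪ X
      · rw [Finset.insert_eq_of_mem h]
        have := hf.mono R (insert e R) (Finset.subset_insert _ _)
        linarith
      · have := hf.submod R (R ∪ X) e Finset.subset_union_left h
        linarith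
  exact (hf.mono _ _ Finset.subset_union_right).trans key

/-- Dismantle `X` one element at a time: the losses telescope, and each is at least the loss from
removing the same element from the full set. -/
theorem sum_sub_erase_le (hf : MonoSubmod f) (X : Finset ι) :
    ∑ i ∈ X, (f X - f (X.erase i)) ≤ f X - f ∅ := by
  induction X using Finset.induction_on with
  | empty => simp
  | insert e X he ih =>
    rw [Finset.sum_insert he, Finset.erase_insert he]
    have : ∑ i ∈ X, (f (insert e X) - f ((insert e X).erase i)) ≤
        ∑ i ∈ X, (f X - f (X.erase i)) := by
      refine Finset.sum_le_sum fun i hi => ?_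
      have := hf.submod (X.erase i) ((insert e X).erase i) i
        (Finset.erase_subset_erase _ (Finset.subset_insert _ _)) (Finset.notMem_erase _ _)
      rwa [Finset.insert_erase hi, Finset.insert_erase (Finset.mem_insert_of_mem hi)] at this
    linarith

/-- Continuous greedy argument: scale the marginals `x` by t from 0 to 1. The multilinear extension
Φ along this ray satisfies Φ' ≥ M - Φ, where M is the correlated expectation, and Φ(0) ≥ 0, so Φ(1)
≥ (1 - 1/e) M. -/
theorem hasCorrelationGap (hf : MonoSubmod f) (h0 : 0 ≤ f ∅) :
    HasCorrelationGap (1 - (Real.exp 1)⁻¹) f := by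
  intro Ω _ μ T hμ hμ1
  set M := ∑ ω, μ ω * f (T ω) with hM
  set x : ι → ℝ := fun i => ∑ ω, if i ∈ T ω then μ ω else 0 with hx
  have hx0 : ∀ i, 0 ≤ x i := fun i => Finset.sum_nonneg fun ω _ => by
    split_ifs; exacts [hμ ω, le_rfl]
  have hx1 : ∀ i, x i ≤ 1 := fun i => hμ1 ▸ Finset.sum_le_sum fun ω _ => by
    split_ifs; exacts [le_rfl, hμ ω]
  -- `le_add_sum` for the sets `T ω`, averaged over `ω`.
  have hpoint : ∀ R, M ≤ f R + ∑ i, x i * (f (insert i R) - f R) := by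
    intro R
    calc M ≤ ∑ ω, μ ω * (f R + ∑ i ∈ T ω, (f (insert i R) - f R)) :=
          Finset.sum_le_sum fun ω _ => mul_le_mul_of_nonneg_left (hf.le_add_sum _ _) (hμ ω)
      _ = f R + ∑ i, x i * (f (insert i R) - f R) := by
          simp_rw [mul_add, Finset.sum_add_distrib, ← Finset.sum_mul, hμ1, one_mul, hx,
            Finset.sum_mul]
          rw [Finset.sum_comm (s := (Finset.univ : Finset ι))]
          congr 1
          refine Finset.sum_congr rfl fun ω _ => ?_
          simp only [Finset.mul_sum, ite_mul, zero_mul, Finset.sum_ite_mem, Finset.univ_inter]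
  have hbnd : ∀ p : ι → ℝ, (∀ i, 0 ≤ p i) → (∀ i, p i ≤ 1) →
      M ≤ multilin p f + ∑ i, x i * (multilin p (fun R => f (insert i R)) - multilin p f) := by
    intro p hp0 hp1
    have h := multilin_mono hp0 hp1 hpoint
    have h1 : multilin p (fun _ => M) = M := prodExp_const _ (sum_bern p) M
    rw [h1] at h
    refine h.trans_eq ?_
    unfold multilin
    rw [prodExp_add, prodExp_sum]
    simp_rw [prodExp_const_mul, prodExp_sub]
  set Φ : ℝ → ℝ := fun t => multilin (fun i => t * x i) f with hΦ
  set D : ℝ → ℝ := fun t => ∑ k, x k * (multilin (fun i => t * x i) (fun R => f (insert k R)) -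
        multilin (fun i => t * x i) (fun R => f (R.erase k))) with hD
  have hder : ∀ t, HasDerivAt Φ (D t) t := fun t => hasDerivAt_multilin x f t
  have hge : ∀ t ∈ Set.Icc (0 : ℝ) 1, M - Φ t ≤ D t := by
    intro t ht
    have hp0 : ∀ i, 0 ≤ t * x i := fun i => mul_nonneg ht.1 (hx0 i)
    have hp1 : ∀ i, t * x i ≤ 1 := fun i => mul_le_one₀ ht.2 (hx0 i) (hx1 i)
    have h1 := hbnd _ hp0 hp1
    have h2 : ∑ i, x i * (multilin (fun i => t * x i) (fun R => f (insert i R)) -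
        multilin (fun i => t * x i) f) ≤ D t := by
      refine Finset.sum_le_sum fun k _ => mul_le_mul_of_nonneg_left ?_ (hx0 k)
      have : multilin (fun i => t * x i) (fun R => f (R.erase k)) ≤
          multilin (fun i => t * x i) f :=
        multilin_mono hp0 hp1 fun R => hf.mono _ _ (Finset.erase_subset _ _)
      linarith
    linarith
  -- Integrating factor for Φ' + Φ ≥ M.
  set Ψ : ℝ → ℝ := fun t => Real.exp t * (Φ t - M) with hΨ
  have hΨd : ∀ t, HasDerivAt Ψ (Real.exp t * (Φ t - M) + Real.exp t * D t) t := fun t =>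
    (Real.hasDerivAt_exp t).mul ((hder t).sub_const M)
  have hmono : MonotoneOn Ψ (Set.Icc 0 1) := by
    refine monotoneOn_of_deriv_nonneg (convex_Icc 0 1)
      (fun t _ => (hΨd t).continuousAt.continuousWithinAt)
      (fun t _ => (hΨd t).differentiableAt.differentiableWithinAt) fun t ht => ?_
    rw [(hΨd t).deriv]
    have := hge t (interior_subset ht)
    have := Real.exp_pos t
    nlinarith
  have h01 := hmono (Set.left_mem_Icc.2 zero_le_one) (Set.right_mem_Icc.2 zero_le_one)
    zero_le_one
  have e0 : Φ 0 = f ∅ := by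
    have : (fun i => (0 : ℝ) * x i) = 0 := by ext; simp
    simp only [hΦ, this, multilin_zero]
  have e1 : Φ 1 = multilin x f := by simp [hΦ]
  simp only [hΨ, e0, e1, Real.exp_zero, one_mul] at h01
  have hpos := Real.exp_pos 1
  have : (Real.exp 1) * ((1 - (Real.exp 1)⁻¹) * M) ≤ Real.exp 1 * multilin x f := by
    have : (Real.exp 1) * ((1 - (Real.exp 1)⁻¹) * M) = Real.exp 1 * M - M := by
      field_simp
    linarith
  exact le_of_mul_le_mul_left this hpos

end MonoSubmod

/-! ### Correlation gaps under a cardinality cap. -/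

/-- The largest value of `f` on a subset with at most `K` elements. -/
def capped (K : ℕ∞) (f : Finset ι → ℝ) (X : Finset ι) : ℝ :=
  (X.powerset.filter fun T => (T.card : ℕ∞) ≤ K).sup' ⟨∅, by simp⟩ f

theorem le_capped {K : ℕ∞} (f : Finset ι → ℝ) {X T : Finset ι} (hT : T ⊆ X)
    (hK : (T.card : ℕ∞) ≤ K) : f T ≤ capped K f X :=
  Finset.le_sup' f (by simp [hT, hK])

theorem exists_capped (K : ℕ∞) (f : Finset ι → ℝ) (X : Finset ι) :
    ∃ T ⊆ X, (T.card : ℕ∞) ≤ K ∧ capped K f X = f T := by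
  obtain ⟨T, hT, h⟩ := Finset.exists_mem_eq_sup'
    (s := X.powerset.filter fun T => (T.card : ℕ∞) ≤ K) ⟨∅, by simp⟩ f
  simp only [Finset.mem_filter, Finset.mem_powerset] at hT
  exact ⟨T, hT.1, hT.2, h⟩

theorem capped_mono (K : ℕ∞) (f : Finset ι → ℝ) {X Y : Finset ι} (h : X ⊆ Y) :
    capped K f X ≤ capped K f Y := by
  obtain ⟨T, hT, hK, e⟩ := exists_capped K f X
  exact e ▸ le_capped f (hT.trans h) hK

theorem capped_nonneg (K : ℕ∞) {f : Finset ι → ℝ} (h : 0 ≤ f ∅) (X : Finset ι) :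
    0 ≤ capped K f X :=
  h.trans (le_capped f (Finset.empty_subset X) (by simp))

theorem capped_empty (K : ℕ∞) (f : Finset ι → ℝ) : capped K f ∅ = f ∅ := by
  obtain ⟨T, hT, -, e⟩ := exists_capped K f ∅
  rw [e, Finset.subset_empty.1 hT]

theorem capped_top {f : Finset ι → ℝ} (hf : ∀ E E', E ⊆ E' → f E ≤ f E') : capped ⊤ f = f := by
  ext X
  obtain ⟨T, hT, -, e⟩ := exists_capped ⊤ f X
  exact le_antisymm (e ▸ hf _ _ hT) (le_capped f subset_rfl le_top)

/-- The total weight of the `K` heaviest elements is a monotone submodular function. -/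
theorem monoSubmod_capped_sum (K : ℕ∞) (w : ι → ℝ) :
    MonoSubmod (capped K fun T => ∑ i ∈ T, w i) := by
  refine ⟨fun _ _ h => capped_mono _ _ h, fun X Y e hXY he => ?_⟩
  set g := capped K fun T => ∑ i ∈ T, w i with hg
  have hleg : ∀ {T Z : Finset ι}, T ⊆ Z → (T.card : ℕ∞) ≤ K → ∑ i ∈ T, w i ≤ g Z :=
    fun h1 h2 => le_capped (fun T => ∑ i ∈ T, w i) h1 h2
  suffices g (insert e Y) + g X ≤ g (insert e X) + g Y by linarith
  -- Exchange argument: the optimal sets `A` for `insert e Y` and `B` for `X` are rearranged, with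
  -- the same total weight, into feasible sets for `insert e X` and `Y`. If `e ∈ A`, then `e` moves
  -- to `B` when `B` is smaller than `A`, and is traded for an element of `B` otherwise.
  obtain ⟨A, hA, hAK, eA⟩ := exists_capped K (fun T => ∑ i ∈ T, w i) (insert e Y)
  obtain ⟨B, hB, hBK, eB⟩ := exists_capped K (fun T => ∑ i ∈ T, w i) X
  rw [← hg] at eA eB
  rw [eA, eB]
  have heX : e ∉ X := fun h => he (hXY h)
  have heB : e ∉ B := fun h => heX (hB h)
  by_cases heA : e ∈ A
  · have hAe : A.erase e ⊆ Y := by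
      intro i hi
      have := hA (Finset.mem_of_mem_erase hi)
      exact Finset.mem_of_mem_insert_of_ne this (Finset.ne_of_mem_erase hi)
    have sA := Finset.add_sum_erase A w heA
    have cA := Finset.card_erase_add_one heA
    by_cases hlt : B.card < A.card
    · have h1 := hleg (Finset.insert_subset_insert e hB) (T := insert e B) (by
        rw [Finset.card_insert_of_notMem heB]
        exact le_trans (by exact_mod_cast hlt) hAK)
      have h2 := hleg hAe (le_trans (by exact_mod_cast Finset.card_erase_le) hAK)
      rw [Finset.sum_insert heB] at h1
      linarith
    · have : ∃ b ∈ B, b ∉ A.erase e := by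
        by_contra! h
        have := Finset.card_le_card h
        omega
      obtain ⟨b, hbB, hbA⟩ := this
      have sB := Finset.add_sum_erase B w hbB
      have cB := Finset.card_erase_add_one hbB
      have heBb : e ∉ B.erase b := fun h => heB (Finset.mem_of_mem_erase h)
      have h1 := hleg (T := insert e (B.erase b))
        (Finset.insert_subset_insert e ((Finset.erase_subset _ _).trans hB)) (by
        rw [Finset.card_insert_of_notMem heBb, cB]; exact hBK)
      have h2 := hleg (T := insert b (A.erase e)) (Z := Y)
        (Finset.insert_subset (hXY (hB hbB)) hAe) (by
        rw [Finset.card_insert_of_notMem hbA, cA]; exact hAK)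
      rw [Finset.sum_insert heBb] at h1
      rw [Finset.sum_insert hbA] at h2
      linarith
  · have h1 := hleg (T := A) (Z := Y) (fun i hi =>
      Finset.mem_of_mem_insert_of_ne (hA hi) (fun h => heA (h ▸ hi))) hAK
    have h2 := hleg (hB.trans (Finset.subset_insert e X)) hBK
    linarith

/-- The map t ↦ t / (1 + t) is increasing and concave on t ≥ 0, and composition with such a map
preserves monotone submodularity. -/
theorem MonoSubmod.div_one_add {h : Finset ι → ℝ} (hh : MonoSubmod h) (h0 : 0 ≤ h ∅) :
    MonoSubmod fun X => h X / (1 + h X) := by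
  have hpos : ∀ X, 0 ≤ h X := fun X => h0.trans (hh.mono _ _ (Finset.empty_subset X))
  refine ⟨fun X Y hXY => ?_, fun X Y e hXY he => ?_⟩
  · have := hh.mono X Y hXY; have := hpos X; have := hpos Y
    rw [div_le_div_iff₀ (by linarith) (by linarith)]
    nlinarith
  · have h1 := hh.mono X Y hXY
    have h2 := hh.submod X Y e hXY he
    have h3 := hh.mono Y (insert e Y) (Finset.subset_insert _ _)
    have h4 := hpos X
    generalize h X = a at *
    generalize h Y = b at *
    obtain ⟨c, hc⟩ : ∃ c, c = h (insert e X) - a := ⟨_, rfl⟩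
    obtain ⟨d, hd⟩ : ∃ d, d = h (insert e Y) - b := ⟨_, rfl⟩
    have ec : h (insert e X) = a + c := by linarith
    have ed : h (insert e Y) = b + d := by linarith
    rw [ec] at h2 ⊢
    rw [ed] at h2 h3 ⊢
    have hd0 : 0 ≤ d := by linarith
    have hdc : d ≤ c := by linarith
    have hb0 : 0 ≤ b := h4.trans h1
    have hc0 : 0 ≤ c := hd0.trans hdc
    have e1 : (b + d) / (1 + (b + d)) - b / (1 + b) = d / ((1 + (b + d)) * (1 + b)) := by
      rw [div_sub_div _ _ (by positivity) (by positivity)]; congr 1; ring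
    have e2 : (a + c) / (1 + (a + c)) - a / (1 + a) = c / ((1 + (a + c)) * (1 + a)) := by
      rw [div_sub_div _ _ (by positivity) (by positivity)]; congr 1; ring
    rw [e1, e2]
    calc d / ((1 + (b + d)) * (1 + b)) ≤ d / ((1 + (a + d)) * (1 + a)) := by gcongr
      _ ≤ c / ((1 + (a + c)) * (1 + a)) := by
        rw [div_le_div_iff₀ (by positivity) (by positivity)]
        nlinarith [mul_nonneg (sub_nonneg.2 hdc) (by positivity : 0 ≤ (1 + a) * (1 + a))]

/-- A monotone submodular function loses at most a proportional share when passing to the best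
subset of a given size. -/
theorem MonoSubmod.exists_subset_card {f : Finset ι → ℝ} (hf : MonoSubmod f) (h0 : f ∅ = 0)
    {K : ℕ} (hK : 1 ≤ K) (n : ℕ) (X : Finset ι) (hX : X.card = K + n) :
    ∃ T ⊆ X, T.card = K ∧ K * f X ≤ (K + n : ℝ) * f T := by
  induction n generalizing X with
  | zero => exact ⟨X, subset_rfl, by simpa using hX, by simp⟩
  | succ n ih =>
    have hc : (X.card : ℝ) = K + n + 1 := by rw [hX]; push_cast; ring
    have hK' : (1 : ℝ) ≤ K := by exact_mod_cast hK
    -- By `sum_sub_erase_le` the cheapest element to remove costs at most a share 1/|X| of `f X`.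
    obtain ⟨i, hi, hle⟩ : ∃ i ∈ X, (K + n : ℝ) * f X ≤ (K + n + 1) * f (X.erase i) := by
      by_contra! h
      have hne : X.Nonempty := Finset.card_pos.1 (by omega)
      have h1 := Finset.sum_lt_sum_of_nonempty hne h
      have h2 := hf.sum_sub_erase_le X
      rw [Finset.sum_sub_distrib, Finset.sum_const, nsmul_eq_mul, hc, h0] at h2
      rw [Finset.sum_const, nsmul_eq_mul, hc, ← Finset.mul_sum] at h1
      have : (0 : ℝ) < K + n + 1 := by positivity
      nlinarith
    obtain ⟨T, hT, hTK, h⟩ := ih (X.erase i) (by rw [Finset.card_erase_of_mem hi, hX]; omega)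
    refine ⟨T, hT.trans (Finset.erase_subset _ _), hTK, ?_⟩
    push_cast
    have hn : (0 : ℝ) < K + n := by positivity
    refine le_of_mul_le_mul_left ?_ hn
    nlinarith

/-- The best K elements keep a share min(1, K/|X|), which is minorized here by an affine function of
|X|, so that expectations need only E[f(R)|R|]. For K = 1 the minorant fails at |X| = 2; for K = 2
it is attained at |X| = 1, 3, 4. -/
theorem MonoSubmod.le_capped_of_two_le {f : Finset ι → ℝ} (hf : MonoSubmod f) (h0 : f ∅ = 0)
    {K : ℕ} (hK : 2 ≤ K) (X : Finset ι) :
    f X * (1 - (X.card - 1) / (3 * K)) ≤ capped K f X := by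
  have hfX : 0 ≤ f X := h0 ▸ hf.mono _ _ (Finset.empty_subset X)
  have hK' : (2 : ℝ) ≤ K := by exact_mod_cast hK
  rcases X.eq_empty_or_nonempty with rfl | hne
  · simp [capped_empty, h0]
  have hc : (1 : ℝ) ≤ X.card := by exact_mod_cast hne.card_pos
  rcases le_or_gt X.card K with h | h
  · refine le_trans ?_ (le_capped f subset_rfl (by exact_mod_cast h))
    refine mul_le_of_le_one_right hfX ?_
    have : 0 ≤ ((X.card : ℝ) - 1) / (3 * K) := div_nonneg (by linarith) (by positivity)
    linarith
  · obtain ⟨d, hd⟩ := Nat.exists_eq_add_of_lt h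
    obtain ⟨T, hT, hTK, hle⟩ := hf.exists_subset_card h0 (by omega : 1 ≤ K) (d + 1) X (by omega)
    refine le_trans ?_ (le_capped f hT (by exact_mod_cast hTK.le))
    have hcard : (X.card : ℝ) = K + (d + 1) := by rw [hd]; push_cast; ring
    rw [hcard]
    push_cast at hle
    have hd0 : (0 : ℝ) ≤ d := by positivity
    -- Integrality matters: for K = 2 the inequality fails at real sizes strictly between 3 and 4.
    -- Hence the case split at `d = 0`.
    have hquad : (3 * K - (K + (d + 1) - 1) : ℝ) * (K + (d + 1)) ≤ 3 * K * K := by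
      rcases Nat.eq_zero_or_pos d with rfl | hdp
      · push_cast; nlinarith
      · have : (1 : ℝ) ≤ d := by exact_mod_cast hdp
        nlinarith [sq_nonneg ((K : ℝ) - (d + 1)),
          mul_nonneg (sub_nonneg.2 hK') (sub_nonneg.2 this)]
    have e : f X * (1 - ((K + (d + 1) : ℝ) - 1) / (3 * K)) =
        f X * (3 * K - (K + (d + 1) - 1)) / (3 * K) := by
      field_simp
    rw [e, div_le_iff₀ (by positivity)]
    have hpos : (0 : ℝ) < K + (d + 1) := by positivity
    refine le_of_mul_le_mul_right ?_ hpos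
    calc f X * (3 * K - (K + (d + 1) - 1)) * (K + (d + 1))
        = f X * ((3 * K - (K + (d + 1) - 1)) * (K + (d + 1))) := by ring
      _ ≤ f X * (3 * K * K) := mul_le_mul_of_nonneg_left hquad hfX
      _ = 3 * K * (K * f X) := by ring
      _ ≤ 3 * K * ((K + (d + 1)) * f T) := mul_le_mul_of_nonneg_left hle (by positivity)
      _ = f T * (3 * K) * (K + (d + 1)) := by ring

/-- By `sum_sub_erase_le`, f(R)|R| exceeds the sum of f(R - i) over i ∈ R by at most f(R); and R - i
is independent of the event i ∈ R, which has probability `p i`. -/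
theorem MonoSubmod.multilin_mul_card_le {f : Finset ι → ℝ} (hf : MonoSubmod f) (h0 : f ∅ = 0)
    {p : ι → ℝ} (hp0 : ∀ i, 0 ≤ p i) (hp1 : ∀ i, p i ≤ 1) :
    multilin p (fun R => f R * R.card) ≤ (∑ i, p i + 1) * multilin p f := by
  have hpoint : ∀ R : Finset ι, f R * R.card ≤
      (∑ i, if i ∈ R then f (R.erase i) else 0) + f R := by
    intro R
    have := hf.sum_sub_erase_le R
    rw [Finset.sum_sub_distrib, Finset.sum_const, nsmul_eq_mul, h0] at this
    rw [Finset.sum_ite_mem, Finset.univ_inter]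
    linarith
  refine (multilin_mono hp0 hp1 hpoint).trans ?_
  have h1 : multilin p (fun R => (∑ i, if i ∈ R then f (R.erase i) else 0) + f R) =
      (∑ i, multilin p (fun R => if i ∈ R then f (R.erase i) else 0)) + multilin p f := by
    unfold multilin
    rw [prodExp_add, prodExp_sum]
  rw [h1, add_mul, one_mul, Finset.sum_mul]
  refine add_le_add_left (Finset.sum_le_sum fun i _ => ?_) _
  rw [multilin_cond p i]
  have hz : multilin p (fun R : Finset ι =>
      if i ∈ R.erase i then f ((R.erase i).erase i) else 0) = 0 := by
    simp [multilin, prodExp]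
  rw [hz, mul_zero, add_zero]
  refine mul_le_mul_of_nonneg_left (multilin_mono hp0 hp1 fun R => ?_) (hp0 i)
  rw [if_pos (Finset.mem_insert_self _ _), Finset.erase_insert_eq_erase]
  exact hf.mono _ _ (Finset.erase_subset _ _)

/-- The two preceding estimates combine to the factor 1 + 1/(3K) - (K + 1)/(3K) = 2/3. -/
theorem MonoSubmod.multilin_capped_ge {f : Finset ι → ℝ} (hf : MonoSubmod f) (h0 : f ∅ = 0)
    {K : ℕ} (hK : 2 ≤ K) {p : ι → ℝ} (hp0 : ∀ i, 0 ≤ p i) (hp1 : ∀ i, p i ≤ 1)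
    (hp : ∑ i, p i ≤ K) : 2 / 3 * multilin p f ≤ multilin p (capped K f) := by
  have h1 := multilin_mono hp0 hp1 (hf.le_capped_of_two_le h0 hK)
  refine le_trans ?_ h1
  have hKpos : (0 : ℝ) < 3 * K := by positivity
  have e : multilin p (fun X => f X * (1 - (X.card - 1) / (3 * K))) =
      (1 + 1 / (3 * K)) * multilin p f - 1 / (3 * K) * multilin p (fun R => f R * R.card) := by
    unfold multilin
    rw [← prodExp_const_mul, ← prodExp_const_mul, ← prodExp_sub]
    congr 1
    ext c
    ring
  rw [e]
  have h2 := hf.multilin_mul_card_le h0 hp0 hp1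
  have hF : 0 ≤ multilin p f := by
    have := multilin_mono hp0 hp1 (f := fun _ => 0) (f' := f)
      (fun R => h0 ▸ hf.mono _ _ (Finset.empty_subset R))
    rwa [show multilin p (fun _ => (0 : ℝ)) = 0 by simp [multilin, prodExp]] at this
  have h3 : multilin p (fun R => f R * R.card) ≤ (K + 1) * multilin p f :=
    h2.trans (mul_le_mul_of_nonneg_right (by linarith) hF)
  have h4 := mul_le_mul_of_nonneg_left h3 (by positivity : 0 ≤ 1 / (3 * (K : ℝ)))
  have h5 : 1 / (3 * (K : ℝ)) * ((K + 1) * multilin p f) =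
      1 / 3 * multilin p f + 1 / (3 * K) * multilin p f := by
    field_simp
  linarith

theorem inv_exp_one_mem : (1 : ℝ) / 3 < (Real.exp 1)⁻¹ ∧ (Real.exp 1)⁻¹ < 1 := by
  have h1 := Real.exp_one_lt_d9
  have h2 := Real.add_one_lt_exp (one_ne_zero (α := ℝ))
  constructor
  · rw [one_div]
    exact inv_strictAnti₀ (by linarith) (by linarith)
  · exact inv_lt_one_of_one_lt₀ (by linarith)

/-- On sets with at most one element `f` agrees with the additive function of its singleton values,
whose capped version is submodular. -/
theorem capped_one_hasCorrelationGap {f : Finset ι → ℝ} (h0 : f ∅ = 0) : HasCorrelationGap (1 - (Real.exp 1)⁻¹) (capped 1 f) := by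
  have e : capped 1 f = capped 1 (fun T => ∑ i ∈ T, f {i}) := by
    have key : ∀ T : Finset ι, (T.card : ℕ∞) ≤ 1 → ∑ i ∈ T, f {i} = f T := by
      intro T hT
      have hT' : T.card ≤ 1 := by exact_mod_cast hT
      rcases T.eq_empty_or_nonempty with rfl | hne
      · simp [h0]
      · obtain ⟨i, rfl⟩ := Finset.card_eq_one.1 (le_antisymm hT' hne.card_pos)
        simp
    ext X
    unfold capped
    refine Finset.sup'_congr _ rfl fun T hT => ?_
    rw [key T (Finset.mem_filter.1 hT).2]
  rw [e]
  refine (monoSubmod_capped_sum 1 fun i => f {i}).hasCorrelationGap (capped_nonneg _ (by simp) _)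

theorem HasCorrelationGap.weaken {α β : ℝ} {g : Finset ι → ℝ} (h : HasCorrelationGap α g)
    (hαβ : β ≤ α) (hg : ∀ X, 0 ≤ g X) : HasCorrelationGap β g := by
  intro Ω _ μ T hμ hμ1
  refine le_trans (mul_le_mul_of_nonneg_right hαβ ?_) (h Ω μ T hμ hμ1)
  exact Finset.sum_nonneg fun ω _ => mul_nonneg (hμ ω) (hg _)

/-- For K ≥ 2 the marginals `x` of the optimal subsets `T ω` sum to at most K and lie below the
marginals `q` of the given sets. So `f` is made independent under `x`, capped there, and the capped
function, being monotone, only grows on passing to `q`. -/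
theorem MonoSubmod.capped_hasCorrelationGap {f : Finset ι → ℝ} (hf : MonoSubmod f)
    (h0 : f ∅ = 0) {K : ℕ} (hK : 1 ≤ K) :
    HasCorrelationGap ((1 - (Real.exp 1)⁻¹) ^ 2) (capped K f) := by
  obtain ⟨he1, he2⟩ := inv_exp_one_mem
  rcases hK.eq_or_lt with rfl | hK
  · refine HasCorrelationGap.weaken (capped_one_hasCorrelationGap h0) ?_ (capped_nonneg _ h0.ge)
    nlinarith
  intro Ω _ μ X hμ hμ1
  choose T hTX hTK hT using fun ω => exists_capped K f (X ω)
  set x : ι → ℝ := fun i => ∑ ω, if i ∈ T ω then μ ω else 0 with hx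
  set q : ι → ℝ := fun i => ∑ ω, if i ∈ X ω then μ ω else 0 with hq
  have hx0 : ∀ i, 0 ≤ x i := fun i => Finset.sum_nonneg fun ω _ => by
    split_ifs; exacts [hμ ω, le_rfl]
  have hxq : ∀ i, x i ≤ q i := fun i => Finset.sum_le_sum fun ω _ => by
    by_cases h : i ∈ T ω
    · simp [h, hTX ω h]
    · simp only [h, if_false]; split_ifs; exacts [hμ ω, le_rfl]
  have hq1 : ∀ i, q i ≤ 1 := fun i => hμ1 ▸ Finset.sum_le_sum fun ω _ => by
    split_ifs; exacts [le_rfl, hμ ω]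
  have hxK : ∑ i, x i ≤ K := by
    rw [hx, Finset.sum_comm]
    calc ∑ ω, ∑ i, (if i ∈ T ω then μ ω else 0) ≤ ∑ ω, μ ω * K := by
          refine Finset.sum_le_sum fun ω _ => ?_
          rw [Finset.sum_ite_mem, Finset.univ_inter, Finset.sum_const, nsmul_eq_mul, mul_comm]
          exact mul_le_mul_of_nonneg_left (by exact_mod_cast hTK ω) (hμ ω)
      _ = K := by rw [← Finset.sum_mul, hμ1, one_mul]
  have h1 := hf.hasCorrelationGap h0.ge Ω μ T hμ hμ1
  have h2 := hf.multilin_capped_ge h0 hK hx0 (fun i => (hxq i).trans (hq1 i)) hxK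
  have h3 := multilin_le_of_le hx0 hxq hq1 (f := capped K f) (fun _ _ h => capped_mono _ _ h)
  simp_rw [hT]
  have hM : 0 ≤ ∑ ω, μ ω * f (T ω) := Finset.sum_nonneg fun ω _ =>
    mul_nonneg (hμ ω) (h0 ▸ hf.mono _ _ (Finset.empty_subset _))
  calc (1 - (Real.exp 1)⁻¹) ^ 2 * ∑ ω, μ ω * f (T ω)
      = (1 - (Real.exp 1)⁻¹) * ((1 - (Real.exp 1)⁻¹) * ∑ ω, μ ω * f (T ω)) := by ring
    _ ≤ 2 / 3 * ((1 - (Real.exp 1)⁻¹) * ∑ ω, μ ω * f (T ω)) :=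
        mul_le_mul_of_nonneg_right (by linarith) (mul_nonneg (by linarith) hM)
    _ ≤ 2 / 3 * multilin x f := mul_le_mul_of_nonneg_left h1 (by norm_num)
    _ ≤ _ := h2.trans h3

end SetFunctions

/-! ### Demand functions, in particular of MNL models. -/

namespace ChoiceModel

variable {β : Type} [Fintype β] [DecidableEq β]

theorem demand_empty (φ : ChoiceModel β) : φ.demand ∅ = 0 := by simp [demand]

theorem IsMNL.demand_eq {φ : ChoiceModel β} {v : β → ℝ}
    (hv : ∀ S : Finset β, φ.prob none S = 1 / (1 + ∑ l ∈ S, v l) ∧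
      ∀ b ∈ S, φ.prob (some b) S = v b / (1 + ∑ l ∈ S, v l)) (S : Finset β) :
    φ.demand S = (∑ l ∈ S, v l) / (1 + ∑ l ∈ S, v l) := by
  rw [demand, Finset.sum_congr rfl (hv S).2, Finset.sum_div]

/-- MNL demand is an increasing function s / (1 + s) of the total weight s, so capping the demand
amounts to capping the weight. -/
theorem IsMNL.capped_monoSubmod {φ : ChoiceModel β} (h : φ.IsMNL) (K : ℕ∞) :
    MonoSubmod (capped K φ.demand) := by
  obtain ⟨v, hv0, hv⟩ := h
  have e : capped K φ.demand = fun X => capped K (fun T => ∑ l ∈ T, v l) X /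
      (1 + capped K (fun T => ∑ l ∈ T, v l) X) := by
    have hs : ∀ T : Finset β, 0 ≤ ∑ l ∈ T, v l := fun T => Finset.sum_nonneg fun i _ => hv0 i
    have hψ : ∀ a b : ℝ, 0 ≤ a → a ≤ b → a / (1 + a) ≤ b / (1 + b) := by
      intro a b ha hab
      rw [div_le_div_iff₀ (by linarith) (by linarith)]
      nlinarith
    ext X
    refine le_antisymm ?_ ?_
    · obtain ⟨T, hT, hK, eT⟩ := exists_capped K φ.demand X
      rw [eT, IsMNL.demand_eq hv]
      exact hψ _ _ (hs T) (le_capped (fun T => ∑ l ∈ T, v l) hT hK)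
    · obtain ⟨T, hT, hK, eT⟩ := exists_capped K (fun T => ∑ l ∈ T, v l) X
      rw [eT, ← IsMNL.demand_eq hv]
      exact le_capped _ hT hK
  rw [e]
  exact (monoSubmod_capped_sum K v).div_one_add (capped_nonneg _ (by simp) _)

theorem MonotoneSubmodular.monoSubmod {φ : ChoiceModel β} (h : φ.MonotoneSubmodular) :
    MonoSubmod φ.demand := ⟨h.1, h.2⟩

theorem IsMNL.monotoneSubmodular {φ : ChoiceModel β} (h : φ.IsMNL) : φ.MonotoneSubmodular := by
  have h' := h.capped_monoSubmod ⊤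
  obtain ⟨v, hv0, hv⟩ := h
  have hs : ∀ T : Finset β, 0 ≤ ∑ l ∈ T, v l := fun T => Finset.sum_nonneg fun i _ => hv0 i
  rw [capped_top] at h'
  · exact ⟨h'.mono, h'.submod⟩
  · intro E E' hE
    have hle := Finset.sum_le_sum_of_subset_of_nonneg hE fun i _ _ => hv0 i
    have := hs E
    rw [IsMNL.demand_eq hv, IsMNL.demand_eq hv, div_le_div_iff₀ (by linarith) (by linarith)]
    nlinarith

theorem IsMNL.weaklySubstitutable {φ : ChoiceModel β} (h : φ.IsMNL) : φ.WeaklySubstitutable := by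
  obtain ⟨v, hv0, hv⟩ := h
  intro A A' hA
  have hle := Finset.sum_le_sum_of_subset_of_nonneg hA fun i _ _ => hv0 i
  have hs : 0 ≤ ∑ l ∈ A, v l := Finset.sum_nonneg fun i _ => hv0 i
  refine ⟨?_, fun a ha => ?_⟩
  · rw [(hv A').1, (hv A).1]
    exact div_le_div_of_nonneg_left zero_le_one (by linarith) (by linarith)
  · rw [(hv A').2 a (hA ha), (hv A).2 a ha]
    exact div_le_div_of_nonneg_left (hv0 a) (by linarith) (by linarith)

end ChoiceModel

section ProdExpEquiv

variable {ι κ α : Type} [Fintype ι] [DecidableEq ι] [Fintype κ] [DecidableEq κ] [Fintype α]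

theorem prodExp_equiv (e : ι ≃ κ) (q : κ → α → ℝ) (h : (ι → α) → ℝ) :
    prodExp (fun i => q (e i)) h = prodExp q fun c => h fun i => c (e i) := by
  unfold prodExp
  rw [← (e.arrowCongr (Equiv.refl α)).sum_comp]
  refine Finset.sum_congr rfl fun c _ => ?_
  congr 1
  · rw [← e.prod_comp]; simp
  · congr 1; ext i; simp

theorem prodExp_of_isEmpty [IsEmpty ι] (q : ι → α → ℝ) (h : (ι → α) → ℝ) (c : ι → α) :
    prodExp q h = h c := by
  unfold prodExp
  rw [Fintype.sum_eq_single c fun c' hc' => absurd (Subsingleton.elim c' c) hc']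
  simp

end ProdExpEquiv

theorem ChoiceModel.sum_option {β : Type} [Fintype β] [DecidableEq β] (φ : ChoiceModel β)
    (E : Finset β) (h : Option β → ℝ) :
    ∑ o, φ.prob o E * h o =
      φ.prob none E * h none + ∑ b ∈ E, φ.prob (some b) E * h (some b) := by
  rw [Fintype.sum_option]
  congr 1
  refine (Finset.sum_subset (Finset.subset_univ E) fun b _ hb => ?_).symm
  rw [φ.eq_zero_of_notMem E b hb, zero_mul]

theorem ChoiceModel.sum_prob {β : Type} [Fintype β] [DecidableEq β] (φ : ChoiceModel β)
    (E : Finset β) : ∑ o, φ.prob o E = 1 := by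
  have := φ.sum_option E fun _ => 1
  simp only [mul_one] at this
  rw [this, φ.sum_eq_one]

/-! ### The value of the responding side. -/

section Respond

variable {C S : Type} [Fintype C] [Fintype S] [DecidableEq C] [DecidableEq S]

/-- The customers that chose the supplier `j`. -/
def choosers (x : C → Option S) (j : S) : Finset C := Finset.univ.filter fun i => x i = some j

/-- Expected number of matches when every supplier is offered an optimal assortment of customers
that chose it. -/
def responseValue (φS : S → ChoiceModel C) (KS : S → ℕ∞) (x : C → Option S) : ℝ :=
  ∑ j, capped (KS j) (φS j).demand (choosers x j)

/-- Number of matches of the supplier `j`. -/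
def matchIndicator (x : C → Option S) (j : S) (o : Option C) : ℝ :=
  if ∃ i, o = some i ∧ x i = some j then 1 else 0

theorem numMatches_eq_sum (x : C → Option S) (y : S → Option C) :
    (numMatches x y : ℝ) = ∑ j, matchIndicator x j (y j) := by
  unfold numMatches matchIndicator
  rw [Finset.sum_boole]
  norm_cast
  refine Finset.card_bij (fun p _ => p.2) ?_ ?_ ?_
  · rintro ⟨i, j⟩ h
    simp only [Finset.mem_filter, Finset.mem_univ, true_and] at h ⊢
    exact ⟨i, h.2, h.1⟩
  · rintro ⟨i, j⟩ h ⟨i', j'⟩ h' e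
    simp only [Finset.mem_filter, Finset.mem_univ, true_and] at h h' e
    subst e
    have : i = i' := by simpa [h.2] using h'.2
    rw [this]
  · intro j hj
    simp only [Finset.mem_filter, Finset.mem_univ, true_and] at hj
    obtain ⟨i, h1, h2⟩ := hj
    exact ⟨(i, j), by simp [h1, h2], rfl⟩

theorem sum_prob_mul_matchIndicator (φ : ChoiceModel C) (E : Finset C) (x : C → Option S) (j : S) :
    ∑ o, φ.prob o E * matchIndicator x j o = ∑ i ∈ E ∩ choosers x j, φ.prob (some i) E := by
  rw [φ.sum_option, ← Finset.sum_filter_add_sum_filter_not E (fun i => x i = some j)]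
  have h1 : matchIndicator x j none = 0 := by simp [matchIndicator]
  have h2 : ∀ i, matchIndicator x j (some i) = if x i = some j then 1 else 0 := by
    intro i; simp [matchIndicator]
  have h3 : E.filter (fun i => x i = some j) = E ∩ choosers x j := by
    ext i; simp [choosers]
  rw [h1, h3, mul_zero, zero_add]
  conv_rhs => rw [← add_zero (∑ i ∈ E ∩ choosers x j, φ.prob (some i) E)]
  congr 1
  · refine Finset.sum_congr rfl fun i hi => ?_
    simp only [choosers, Finset.mem_inter, Finset.mem_filter] at hi
    simp [h2, hi.2.2]
  · refine Finset.sum_eq_zero fun i hi => ?_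
    simp [h2, (Finset.mem_filter.1 hi).2]

/-- Displayed customers that did not choose `j` yield no match, and under weak substitutability
removing them lowers no other choice probability. Hence both display rules have the same upper
bound. -/
theorem sum_prob_mul_matchIndicator_le (φ : ChoiceModel C) (E : Finset C) (x : C → Option S)
    (j : S) (K : ℕ∞) (hK : (E.card : ℕ∞) ≤ K)
    (h : φ.WeaklySubstitutable ∨ ∀ i ∈ E, x i = some j) :
    ∑ o, φ.prob o E * matchIndicator x j o ≤ capped K φ.demand (choosers x j) := by
  rw [sum_prob_mul_matchIndicator]
  refine le_trans ?_ (le_capped φ.demand (T := E ∩ choosers x j) Finset.inter_subset_right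
    (le_trans (by exact_mod_cast Finset.card_le_card Finset.inter_subset_left) hK))
  rcases h with h | h
  · exact Finset.sum_le_sum fun i hi => (h _ _ Finset.inter_subset_left).2 i hi
  · have : E ∩ choosers x j = E := Finset.inter_eq_left.2 fun i hi => by simp [choosers, h i hi]
    rw [this]; exact le_rfl

theorem updateChoices_of_mem {α β : Type} [DecidableEq α] (x : α → Option β) {A : Finset α}
    (c : A → Option β) {a : α} (h : a ∈ A) : updateChoices x A c a = c ⟨a, h⟩ := by
  simp [updateChoices, h]

theorem updateChoices_of_notMem {α β : Type} [DecidableEq α] (x : α → Option β) {A : Finset α}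
    (c : A → Option β) {a : α} (h : a ∉ A) : updateChoices x A c a = x a := by
  simp [updateChoices, h]

theorem updateChoices_empty {α β : Type} [DecidableEq α] (x : α → Option β)
    (c : (∅ : Finset α) → Option β) : updateChoices x ∅ c = x := by
  ext a; simp [updateChoices]

namespace Policy

theorem expectedMatchesFrom_step (φC : C → ChoiceModel S) (φS : S → ChoiceModel C)
    {R : Finset C} {T : Finset S} (A : Finset C) (B : Finset S) (hA : A ⊆ R) (hB : B ⊆ T)
    (showC : A → Finset S) (showS : B → Finset C)
    (next : (A → Option S) → (B → Option C) → Policy C S (R \ A) (T \ B))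
    (x : C → Option S) (y : S → Option C) :
    (step A B hA hB showC showS next).expectedMatchesFrom φC φS x y =
      prodExp (fun (i : A) o => (φC i).prob o (showC i)) fun c =>
        prodExp (fun (j : B) o => (φS j).prob o (showS j)) fun d =>
          (next c d).expectedMatchesFrom φC φS (updateChoices x A c) (updateChoices y B d) := by
  rw [expectedMatchesFrom]
  unfold prodExp
  refine Finset.sum_congr rfl fun c _ => ?_
  rw [Finset.mul_sum]
  exact Finset.sum_congr rfl fun d _ => mul_assoc _ _ _

/-- Induction over the policy: a processed supplier counts its realized match, one still in `T` the
most it can contribute; processing it replaces the latter by an expectation that is no larger. -/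
theorem expectedMatchesFrom_le_of_eq_empty (φC : C → ChoiceModel S) (φS : S → ChoiceModel C)
    (KC : C → ℕ∞) (KS : S → ℕ∞) {R : Finset C} {T : Finset S} (π : Policy C S R T) :
    ∀ (x : C → Option S) (y : S → Option C), R = ∅ → π.RespectsCaps KC KS →
      ((∀ j, (φS j).WeaklySubstitutable) ∨ π.ShowsChoosersOnly x y) →
      π.expectedMatchesFrom φC φS x y ≤
        ∑ j, if j ∈ T then capped (KS j) (φS j).demand (choosers x j)
          else matchIndicator x j (y j) := by
  induction π with
  | finish hR hT =>
    intro x y _ _ _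
    subst hT
    simp [expectedMatchesFrom, numMatches_eq_sum]
  | @step R T A B hA hB showC showS next ih =>
    intro x y hR hcap hshow
    subst hR
    obtain rfl : A = ∅ := Finset.subset_empty.1 hA
    rw [expectedMatchesFrom_step, prodExp_of_isEmpty _ _ (fun _ => none)]
    simp only [RespectsCaps] at hcap
    have hnext : ∀ d, (next (fun _ => none) d).expectedMatchesFrom φC φS
        (updateChoices x ∅ fun _ => none) (updateChoices y B d) ≤
        ∑ j, if j ∈ T \ B then capped (KS j) (φS j).demand (choosers x j)
          else matchIndicator x j (updateChoices y B d j) := by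
      intro d
      have h := ih (fun _ => none) d (updateChoices x ∅ fun _ => none) (updateChoices y B d)
        (by simp) (hcap.2.2 _ _) (hshow.imp_right fun h => by
          rw [ShowsChoosersOnly] at h; exact h.2.2 _ _)
      simpa only [updateChoices_empty] using h
    refine (prodExp_mono (fun _ _ => ChoiceModel.nonneg _ _ _) hnext).trans ?_
    rw [prodExp_sum]
    refine Finset.sum_le_sum fun j _ => ?_
    have hq : ∀ j : B, ∑ o, (φS j).prob o (showS j) = 1 := fun j => (φS j).sum_prob _
    by_cases hjB : j ∈ B
    · have hjT := hB hjB
      simp only [Finset.mem_sdiff, hjB, hjT, not_true, and_false, if_false, if_true,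
        updateChoices_of_mem]
      rw [prodExp_coord _ hq ⟨j, hjB⟩ (matchIndicator x j)]
      refine sum_prob_mul_matchIndicator_le _ _ _ _ _ (hcap.2.1 ⟨j, hjB⟩) ?_
      rcases hshow with h | h
      · exact Or.inl (h j)
      · rw [ShowsChoosersOnly] at h
        exact Or.inr (h.1 rfl ⟨j, hjB⟩)
    · by_cases hjT : j ∈ T
      · simp only [Finset.mem_sdiff, hjB, hjT, not_false_eq_true, and_true, if_true]
        rw [prodExp_const _ hq]
      · simp only [Finset.mem_sdiff, hjT, false_and, if_false, updateChoices_of_notMem y _ hjB]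
        rw [prodExp_const _ hq]
  | mix k w hw hsum next ih =>
    intro x y hR hcap hshow
    simp only [RespectsCaps] at hcap
    rw [expectedMatchesFrom]
    have := Finset.sum_le_sum fun l (_ : l ∈ Finset.univ) => mul_le_mul_of_nonneg_left
      (ih l x y hR (hcap l) (hshow.imp_right fun h => by
        rw [ShowsChoosersOnly] at h; exact h l)) (hw l)
    rwa [← Finset.sum_mul, hsum, one_mul] at this

theorem expectedMatchesFrom_le_responseValue (φC : C → ChoiceModel S) (φS : S → ChoiceModel C)
    (KC : C → ℕ∞) (KS : S → ℕ∞) {R : Finset C} {T : Finset S} (π : Policy C S R T)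
    (x : C → Option S) (y : S → Option C) (hR : R = ∅) (hT : T = Finset.univ)
    (hcap : π.RespectsCaps KC KS)
    (hshow : (∀ j, (φS j).WeaklySubstitutable) ∨ π.ShowsChoosersOnly x y) :
    π.expectedMatchesFrom φC φS x y ≤ responseValue φS KS x := by
  refine (expectedMatchesFrom_le_of_eq_empty φC φS KC KS π x y hR hcap hshow).trans_eq ?_
  simp [responseValue, hT]

/-- The bound is attained by processing all suppliers in one step. As only choosers are shown, the
policy is admissible under both display rules. -/
theorem exists_responseValue (φC : C → ChoiceModel S) (φS : S → ChoiceModel C)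
    (KC : C → ℕ∞) (KS : S → ℕ∞) (t : Adaptivity) {R : Finset C} {T : Finset S} (hR : R = ∅)
    (hT : T = Finset.univ) (x : C → Option S) (y : S → Option C) :
    ∃ π : Policy C S R T, π.CustomersFirst t.Batch ∧ π.RespectsCaps KC KS ∧
      π.ShowsChoosersOnly x y ∧ π.expectedMatchesFrom φC φS x y = responseValue φS KS x := by
  choose E hE hEK hEv using fun j => exists_capped (KS j) (φS j).demand (choosers x j)
  refine ⟨step ∅ T (Finset.empty_subset _) subset_rfl (fun _ => ∅) (fun j => E j)
    (fun _ _ => finish (by simp [hR]) (by simp)), ?_, ?_, ?_, ?_⟩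
  · simp [CustomersFirst, hR]
  · simp [RespectsCaps, hEK]
  · rw [ShowsChoosersOnly]
    refine ⟨fun _ j i hi => ?_, fun _ i => absurd i.2 (Finset.notMem_empty _), fun c d => by
      simp [ShowsChoosersOnly]⟩
    simpa [choosers] using hE j hi
  · subst hT
    rw [expectedMatchesFrom_step, prodExp_of_isEmpty _ _ (fun _ => none)]
    simp only [expectedMatchesFrom, updateChoices_empty, numMatches_eq_sum]
    rw [prodExp_sum, responseValue]
    refine Finset.sum_congr rfl fun j _ => ?_
    simp only [updateChoices_of_mem y _ (Finset.mem_univ j)]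
    have hq : ∀ j : (Finset.univ : Finset S), ∑ o, (φS j).prob o (E j) = 1 :=
      fun j => (φS j).sum_prob _
    rw [prodExp_coord _ hq ⟨j, Finset.mem_univ j⟩ (matchIndicator x j),
      sum_prob_mul_matchIndicator, hEv, Finset.inter_eq_left.2 (hE j), ChoiceModel.demand]

end Policy

end Respond

/-! ### From adaptive to static policies, customers initiating. -/

section OneSided

variable {C S : Type} [Fintype C] [Fintype S] [DecidableEq C] [DecidableEq S]

/-- Probability of the outcome `o` in the coordinate `i` under the weights `μ`. -/
def marginal (μ : (C → Option S) → ℝ) (i : C) (o : Option S) : ℝ :=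
  ∑ z, if z i = o then μ z else 0

/-- The choice probabilities of an agent facing a random assortment of size at most `K`. -/
def choiceHull (φ : ChoiceModel S) (K : ℕ∞) : Set (Option S → ℝ) :=
  convexHull ℝ {r | ∃ E : Finset S, (E.card : ℕ∞) ≤ K ∧ r = fun o => φ.prob o E}

theorem sum_eq_one_of_mem_choiceHull {φ : ChoiceModel S} {K : ℕ∞} {r : Option S → ℝ}
    (h : r ∈ choiceHull φ K) : (∀ o, 0 ≤ r o) ∧ ∑ o, r o = 1 := by
  have hsub : choiceHull φ K ⊆ stdSimplex ℝ (Option S) :=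
    convexHull_min (by
      rintro _ ⟨E, -, rfl⟩
      exact ⟨fun o => φ.nonneg o E, φ.sum_prob E⟩) (convex_stdSimplex ℝ _)
  exact hsub h

theorem marginal_sum {κ : Type} [Fintype κ] (w : κ → ℝ) (μ : κ → (C → Option S) → ℝ) (i : C) :
    marginal (fun z => ∑ k, w k * μ k z) i = ∑ k, w k • marginal (μ k) i := by
  ext o
  simp only [marginal, Finset.sum_apply, Pi.smul_apply, smul_eq_mul, Finset.mul_sum]
  rw [Finset.sum_comm]
  refine Finset.sum_congr rfl fun z _ => ?_
  split_ifs <;> simp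

/-- `μ` is a probability distribution over choice profiles extending the choices `x` of the
processed customers, the marginals of the remaining customers being feasible. -/
structure IsLaw (φC : C → ChoiceModel S) (KC : C → ℕ∞) (R : Finset C) (x : C → Option S)
    (μ : (C → Option S) → ℝ) : Prop where
  nonneg : ∀ z, 0 ≤ μ z
  sum_eq_one : ∑ z, μ z = 1
  marginal_of_notMem : ∀ i ∉ R, marginal μ i = fun o => if x i = o then 1 else 0
  marginal_mem : ∀ i ∈ R, marginal μ i ∈ choiceHull (φC i) (KC i)

theorem sum_average {κ : Type} [Fintype κ] (w : κ → ℝ) (μ : κ → (C → Option S) → ℝ)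
    (h : (C → Option S) → ℝ) :
    ∑ z, (∑ k, w k * μ k z) * h z = ∑ k, w k * ∑ z, μ k z * h z := by
  simp_rw [Finset.sum_mul, Finset.mul_sum]
  rw [Finset.sum_comm]
  exact Finset.sum_congr rfl fun k _ => Finset.sum_congr rfl fun z _ => by ring

theorem sum_average_eq_one {κ : Type} [Fintype κ] {w : κ → ℝ} {μ : κ → (C → Option S) → ℝ}
    (hw : ∑ k, w k = 1) (hμ : ∀ k, ∑ z, μ k z = 1) : ∑ z, ∑ k, w k * μ k z = 1 := by
  have := sum_average w μ fun _ => 1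
  simpa [hμ, hw] using this

theorem isLaw_dirac (φC : C → ChoiceModel S) (KC : C → ℕ∞) (x : C → Option S) :
    IsLaw φC KC ∅ x (fun z => if z = x then 1 else 0) := by
  refine ⟨fun z => by positivity, by simp, fun i _ => ?_, by simp⟩
  ext o
  unfold marginal
  rw [Finset.sum_eq_single x]
  · simp
  · intro z _ hz; simp [hz]
  · simp

namespace Policy

/-- The laws of the branches are averaged. After every history the customer being processed faces
some feasible assortment, so its overall marginal is a convex combination; the dependence between
customers is not recorded. -/
theorem exists_isLaw (φC : C → ChoiceModel S) (φS : S → ChoiceModel C)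
    (KC : C → ℕ∞) (KS : S → ℕ∞) (t : Adaptivity) {R : Finset C} {T : Finset S}
    (π : Policy C S R T) : ∀ (x : C → Option S) (y : S → Option C), T = Finset.univ →
      π.CustomersFirst t.Batch → π.RespectsCaps KC KS →
      ((∀ j, (φS j).WeaklySubstitutable) ∨ π.ShowsChoosersOnly x y) →
      ∃ μ, IsLaw φC KC R x μ ∧
        π.expectedMatchesFrom φC φS x y ≤ ∑ z, μ z * responseValue φS KS z := by
  induction π with
  | finish hR hT =>
    intro x y hT' _ hcap hshow
    have h := expectedMatchesFrom_le_responseValue φC φS KC KS _ x y hR hT' hcap hshow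
    subst hR
    exact ⟨_, isLaw_dirac φC KC x, h.trans (by simp)⟩
  | @step R T A B hA hB showC showS next ih =>
    intro x y hT hfirst hcap hshow
    rcases R.eq_empty_or_nonempty with rfl | hR
    · have h := expectedMatchesFrom_le_responseValue φC φS KC KS _ x y rfl hT hcap hshow
      exact ⟨_, isLaw_dirac φC KC x, h.trans (by simp)⟩
    rw [CustomersFirst] at hfirst
    obtain ⟨-, hBe⟩ := hfirst.1 hR
    subst hBe
    rw [RespectsCaps] at hcap
    have := fun c : A → Option S => ih c (fun _ => none) (updateChoices x A c)
      (updateChoices y ∅ fun _ => none) (by simp [hT]) (hfirst.2 _ _) (hcap.2.2 _ _)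
      (hshow.imp_right fun h => by rw [ShowsChoosersOnly] at h; exact h.2.2 _ _)
    choose μ hμ hle using this
    set q : A → Option S → ℝ := fun i o => (φC i).prob o (showC i) with hq
    have hq1 : ∀ i, ∑ o, q i o = 1 := fun i => (φC i).sum_prob _
    have hw : ∑ c : A → Option S, ∏ i, q i (c i) = 1 := sum_prod_eq_one q hq1
    have hw0 : ∀ c : A → Option S, 0 ≤ ∏ i, q i (c i) := fun c =>
      Finset.prod_nonneg fun i _ => (φC i).nonneg _ _
    refine ⟨fun z => ∑ c : A → Option S, (∏ i, q i (c i)) * μ c z,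
      ⟨fun z => Finset.sum_nonneg fun c _ => mul_nonneg (hw0 c) ((hμ c).nonneg z),
        sum_average_eq_one hw fun c => (hμ c).sum_eq_one, fun i hi => ?_, fun i hi => ?_⟩, ?_⟩
    · have hiA : i ∉ A := fun h => hi (hA h)
      rw [marginal_sum]
      have : ∀ c, marginal (μ c) i = fun o => if x i = o then 1 else 0 := fun c => by
        rw [(hμ c).marginal_of_notMem i (by simp [hi]), updateChoices_of_notMem x c hiA]
      simp_rw [this, ← Finset.sum_smul, hw, one_smul]
    · rw [marginal_sum]
      by_cases hiA : i ∈ A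
      -- In the branch `c` the choice of `i` is already fixed by `c`, so averaging over `c` gives
      -- exactly the choice distribution for the displayed assortment.
      · refine subset_convexHull ℝ _ ⟨showC ⟨i, hiA⟩, hcap.1 ⟨i, hiA⟩, ?_⟩
        ext o
        have : ∀ c, marginal (μ c) i = fun o => if c ⟨i, hiA⟩ = o then 1 else 0 := fun c => by
          rw [(hμ c).marginal_of_notMem i (by simp [hiA]), updateChoices_of_mem x c hiA]
        simp only [this, Finset.sum_apply, Pi.smul_apply, smul_eq_mul]
        have h := prodExp_coord q hq1 ⟨i, hiA⟩ fun o' => if o' = o then (1 : ℝ) else 0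
        rw [prodExp] at h
        rw [h]
        simp [hq]
      · exact (convex_convexHull ℝ _).sum_mem (fun c _ => hw0 c) hw fun c _ =>
          (hμ c).marginal_mem i (by simp [hi, hiA])
    · rw [expectedMatchesFrom_step, sum_average]
      refine (prodExp_mono (fun _ _ => ChoiceModel.nonneg _ _ _) fun c => ?_)
      rw [prodExp_of_isEmpty _ _ (fun _ => none)]
      exact hle c
  | mix k w hw hsum next ih =>
    intro x y hT hfirst hcap hshow
    rw [CustomersFirst] at hfirst
    rw [RespectsCaps] at hcap
    have := fun l => ih l x y hT (hfirst l) (hcap l) (hshow.imp_right fun h => by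
      rw [ShowsChoosersOnly] at h; exact h l)
    choose μ hμ hle using this
    refine ⟨fun z => ∑ l, w l * μ l z,
      ⟨fun z => Finset.sum_nonneg fun l _ => mul_nonneg (hw l) ((hμ l).nonneg z),
        sum_average_eq_one hsum fun l => (hμ l).sum_eq_one, fun i hi => ?_, fun i hi => ?_⟩, ?_⟩
    · rw [marginal_sum]
      simp_rw [(hμ _).marginal_of_notMem i hi, ← Finset.sum_smul, hsum, one_smul]
    · rw [marginal_sum]
      exact (convex_convexHull ℝ _).sum_mem (fun l _ => hw l) hsum fun l _ =>
        (hμ l).marginal_mem i hi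
    · rw [expectedMatchesFrom, sum_average]
      exact Finset.sum_le_sum fun l _ => mul_le_mul_of_nonneg_left (hle l) (hw l)

/-- Expected value of displaying the assortments `E` to all customers simultaneously and
responding optimally. -/
def _root_.staticValue (φC : C → ChoiceModel S) (φS : S → ChoiceModel C) (KS : S → ℕ∞)
    (E : C → Finset S) : ℝ :=
  prodExp (fun i o => (φC i).prob o (E i)) (responseValue φS KS)

/-- The identification of the universal finset with the type. -/
def _root_.univSubtypeEquiv (C : Type) [Fintype C] : {i // i ∈ (Finset.univ : Finset C)} ≃ C :=
  Equiv.subtypeUnivEquiv Finset.mem_univ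

theorem _root_.prodExp_updateChoices_univ (q : C → Option S → ℝ) (h : (C → Option S) → ℝ)
    (x : C → Option S) :
    prodExp (fun (i : (Finset.univ : Finset C)) o => q i o)
      (fun c => h (updateChoices x Finset.univ c)) = prodExp q h := by
  have e := prodExp_equiv (univSubtypeEquiv C) q
    (fun c => h (updateChoices x Finset.univ c))
  have e2 : ∀ c : C → Option S,
      updateChoices x Finset.univ (fun i => c (univSubtypeEquiv C i)) = c := by
    intro c; ext i; simp [updateChoices, univSubtypeEquiv]
  simp_rw [e2] at e
  exact e

theorem exists_static (φC : C → ChoiceModel S) (φS : S → ChoiceModel C)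
    (KC : C → ℕ∞) (KS : S → ℕ∞) (E : C → Finset S) (hE : ∀ i, ((E i).card : ℕ∞) ≤ KC i) :
    ∃ π : Policy C S Finset.univ Finset.univ, π.CustomersFirst Adaptivity.isStatic.Batch ∧
      π.RespectsCaps KC KS ∧ π.ShowsChoosersOnly (fun _ => none) (fun _ => none) ∧
      π.expectedMatches φC φS = staticValue φC φS KS E := by
  choose π h1 h2 h3 h4 using fun (c : ↥(Finset.univ : Finset C) → Option S)
    (d : ↥(∅ : Finset S) → Option C) => exists_responseValue φC φS KC KS .isStatic
      (R := Finset.univ \ Finset.univ) (T := Finset.univ \ ∅) (by simp) (by simp)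
      (updateChoices (fun _ => none) Finset.univ c) (updateChoices (fun _ => none) ∅ d)
  refine ⟨step Finset.univ ∅ subset_rfl (Finset.empty_subset _) (fun i => E i) (fun _ => ∅) π,
    ?_, ?_, ?_, ?_⟩
  · rw [CustomersFirst]
    exact ⟨fun _ => ⟨rfl, rfl⟩, h1⟩
  · rw [RespectsCaps]
    exact ⟨fun i => hE i, fun j => absurd j.2 (Finset.notMem_empty _), h2⟩
  · rw [ShowsChoosersOnly]
    refine ⟨fun _ j => absurd j.2 (Finset.notMem_empty _), fun hT i j => ?_, h3⟩
    exact absurd (hT ▸ Finset.mem_univ j) (Finset.notMem_empty _)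
  · rw [expectedMatches, expectedMatchesFrom_step]
    have e : ∀ c, (prodExp (fun (j : (∅ : Finset S)) o => (φS j).prob o ∅) fun d =>
        (π c d).expectedMatchesFrom φC φS (updateChoices (fun _ => none) Finset.univ c)
          (updateChoices (fun _ => none) ∅ d)) =
        responseValue φS KS (updateChoices (fun _ => none) Finset.univ c) := by
      intro c
      rw [prodExp_of_isEmpty _ _ (fun _ => none), h4]
    simp_rw [e]
    exact prodExp_updateChoices_univ (fun i o => (φC i).prob o (E i)) _ _

theorem static_le (φC : C → ChoiceModel S) (φS : S → ChoiceModel C)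
    (KC : C → ℕ∞) (KS : S → ℕ∞) (M : ℝ)
    (hM : ∀ E : C → Finset S, (∀ i, ((E i).card : ℕ∞) ≤ KC i) → staticValue φC φS KS E ≤ M)
    {R : Finset C} {T : Finset S} (π : Policy C S R T) :
    ∀ (x : C → Option S) (y : S → Option C), R = Finset.univ → T = Finset.univ →
      π.CustomersFirst Adaptivity.isStatic.Batch → π.RespectsCaps KC KS →
      ((∀ j, (φS j).WeaklySubstitutable) ∨ π.ShowsChoosersOnly x y) →
      π.expectedMatchesFrom φC φS x y ≤ M := by
  -- Without any customers the batch condition is vacuous and the policy may respond at once.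
  have hempty : ∀ {R : Finset C} {T : Finset S} (π : Policy C S R T) (x : C → Option S)
      (y : S → Option C), R = Finset.univ → T = Finset.univ → π.RespectsCaps KC KS →
      ((∀ j, (φS j).WeaklySubstitutable) ∨ π.ShowsChoosersOnly x y) → R = ∅ →
      π.expectedMatchesFrom φC φS x y ≤ M := by
    intro R T π x y hR hT hcap hshow hR0
    refine (expectedMatchesFrom_le_responseValue φC φS KC KS π x y hR0 hT hcap hshow).trans ?_
    have : IsEmpty C := ⟨fun i => Finset.notMem_empty i (hR0 ▸ hR ▸ Finset.mem_univ i)⟩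
    have h := hM (fun _ => ∅) (by simp)
    rwa [staticValue, prodExp_of_isEmpty _ _ x] at h
  induction π with
  | finish hR hT =>
    intro x y hR' hT' _ hcap hshow
    exact hempty _ x y hR' hT' hcap hshow hR
  | @step R T A B hA hB showC showS next ih =>
    intro x y hR hT hfirst hcap hshow
    rcases R.eq_empty_or_nonempty with hR0 | hR0
    · exact hempty _ x y hR hT hcap hshow hR0
    rw [CustomersFirst] at hfirst
    obtain ⟨hAR, hBe⟩ := hfirst.1 hR0
    simp only [Adaptivity.Batch] at hAR
    rw [RespectsCaps] at hcap
    subst hBe hR hT hAR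
    refine le_trans ?_ (hM (fun i => showC ⟨i, Finset.mem_univ i⟩)
      fun i => hcap.1 ⟨i, Finset.mem_univ i⟩)
    rw [staticValue, ← prodExp_updateChoices_univ _ _ x, expectedMatchesFrom_step]
    refine prodExp_mono (fun _ _ => ChoiceModel.nonneg _ _ _) fun c => ?_
    rw [prodExp_of_isEmpty _ _ (fun _ => none)]
    exact expectedMatchesFrom_le_responseValue φC φS KC KS _ _ _ (by simp) (by simp)
      (hcap.2.2 _ _) (hshow.imp_right fun h => by rw [ShowsChoosersOnly] at h; exact h.2.2 _ _)
  | mix k w hw hsum next ih =>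
    intro x y hR hT hfirst hcap hshow
    rw [CustomersFirst] at hfirst
    rw [RespectsCaps] at hcap
    rw [expectedMatchesFrom]
    have := Finset.sum_le_sum fun l (_ : l ∈ Finset.univ) => mul_le_mul_of_nonneg_left
      (ih l x y hR hT (hfirst l) (hcap l) (hshow.imp_right fun h => by
        rw [ShowsChoosersOnly] at h; exact h l)) (hw l)
    rwa [← Finset.sum_mul, hsum, one_mul] at this

/-- For independent customers the value is linear in the distribution of each one, the others being
fixed, so some pure assortment is at least as good as a mixture. The customers are treated one after
another. -/
theorem exists_staticValue_ge (φC : C → ChoiceModel S) (φS : S → ChoiceModel C)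
    (KC : C → ℕ∞) (KS : S → ℕ∞) (q : C → Option S → ℝ)
    (hq : ∀ i, q i ∈ choiceHull (φC i) (KC i)) :
    ∃ E : C → Finset S, (∀ i, ((E i).card : ℕ∞) ≤ KC i) ∧
      prodExp q (responseValue φS KS) ≤ staticValue φC φS KS E := by
  have key : ∀ s : Finset C, ∃ E : C → Finset S, (∀ i, ((E i).card : ℕ∞) ≤ KC i) ∧
      prodExp q (responseValue φS KS) ≤
        prodExp (s.piecewise (fun i o => (φC i).prob o (E i)) q) (responseValue φS KS) := by
    intro s
    induction s using Finset.induction_on with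
    | empty => exact ⟨fun _ => ∅, by simp, by simp⟩
    | insert k s hk ih =>
      obtain ⟨E, hE, hle⟩ := ih
      set r := s.piecewise (fun i o => (φC i).prob o (E i)) q with hr
      have hrk : r k = q k := by simp [hr, hk]
      set v : Option S → ℝ := fun a => prodExp r fun c =>
        responseValue φS KS (Function.update c k a) with hv
      have hcond : ∀ u : Option S → ℝ,
          prodExp (Function.update r k u) (responseValue φS KS) = ∑ a, u a * v a := fun u =>
        prodExp_update r k (by rw [hrk]; exact (sum_eq_one_of_mem_choiceHull (hq k)).2) u _
      obtain ⟨F, hF, hFle⟩ : ∃ F : Finset S, (F.card : ℕ∞) ≤ KC k ∧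
          ∑ a, q k a * v a ≤ ∑ a, (φC k).prob a F * v a := by
        -- If every pure assortment were strictly worse than `q k`, the open half-space below its
        -- value would contain the convex hull, hence `q k` itself.
        by_contra! h
        have hlin : IsLinearMap ℝ fun u : Option S → ℝ => ∑ a, u a * v a :=
          ⟨fun u u' => by simp [add_mul, Finset.sum_add_distrib],
            fun b u => by
              simp only [Finset.mul_sum, mul_assoc, Pi.smul_apply, smul_eq_mul]⟩
        have hsub : choiceHull (φC k) (KC k) ⊆ {u | ∑ a, u a * v a < ∑ a, q k a * v a} :=
          convexHull_min (by rintro _ ⟨F, hF, rfl⟩; exact h F hF)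
            (convex_halfSpace_lt hlin _)
        exact lt_irrefl (∑ a, q k a * v a) (hsub (hq k))
      refine ⟨Function.update E k F, fun i => ?_, hle.trans ?_⟩
      · by_cases hi : i = k
        · subst hi; simpa using hF
        · simpa [hi] using hE i
      · have e : (insert k s).piecewise
            (fun i o => (φC i).prob o (Function.update E k F i)) q =
            Function.update r k (fun o => (φC k).prob o F) := by
          ext i o
          by_cases hi : i = k
          · subst hi; simp
          · by_cases his : i ∈ s <;> simp [hi, his, hr]
        rw [e, hcond, ← Function.update_eq_self k r, hcond, hrk]
        exact hFle
  obtain ⟨E, hE, hle⟩ := key Finset.univ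
  exact ⟨E, hE, by simpa [staticValue] using hle⟩

theorem exists_static_ge (φC : C → ChoiceModel S) (φS : S → ChoiceModel C)
    (KC : C → ℕ∞) (KS : S → ℕ∞) (α : ℝ)
    (hα : ∀ j, HasCorrelationGap α (capped (KS j) (φS j).demand))
    (π : Policy C S Finset.univ Finset.univ) (hfirst : π.CustomersFirst Adaptivity.isAdaptive.Batch)
    (hα0 : 0 ≤ α) (hcap : π.RespectsCaps KC KS)
    (hshow : (∀ j, (φS j).WeaklySubstitutable) ∨
      π.ShowsChoosersOnly (fun _ => none) (fun _ => none)) :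
    ∃ π' : Policy C S Finset.univ Finset.univ, π'.CustomersFirst Adaptivity.isStatic.Batch ∧
      π'.RespectsCaps KC KS ∧ π'.ShowsChoosersOnly (fun _ => none) (fun _ => none) ∧
      α * π.expectedMatches φC φS ≤ π'.expectedMatches φC φS := by
  obtain ⟨μ, hμ, hle⟩ := exists_isLaw φC φS KC KS .isAdaptive π _ _ rfl hfirst hcap hshow
  have hq := fun i => hμ.marginal_mem i (Finset.mem_univ i)
  obtain ⟨E, hE, hEle⟩ := exists_staticValue_ge φC φS KC KS (marginal μ) hq
  obtain ⟨π', h1, h2, h3, h4⟩ := exists_static φC φS KC KS E hE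
  refine ⟨π', h1, h2, h3, ?_⟩
  rw [h4]
  refine le_trans ?_ hEle
  refine (mul_le_mul_of_nonneg_left hle hα0).trans ?_
  have e1 : ∑ z, μ z * responseValue φS KS z =
      ∑ j, ∑ z, μ z * capped (KS j) (φS j).demand (choosers z j) := by
    simp_rw [responseValue, Finset.mul_sum]
    exact Finset.sum_comm
  have e2 : prodExp (marginal μ) (responseValue φS KS) =
      ∑ j, prodExp (marginal μ) fun z => capped (KS j) (φS j).demand (choosers z j) :=
    prodExp_sum _ _ _
  rw [e1, e2, Finset.mul_sum]
  refine Finset.sum_le_sum fun j _ => (hα j _ μ (fun z => choosers z j) hμ.nonneg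
    hμ.sum_eq_one).trans_eq ?_
  -- Under the product of the marginals the events `z i = some j` are independent, so the
  -- expectation is the multilinear extension at the probabilities of choosing `j`.
  have e3 : ∀ z : C → Option S, choosers z j = successes fun i => decide (z i = some j) := by
    intro z; ext i; simp [choosers, successes]
  simp_rw [e3]
  rw [prodExp_map (marginal μ) (fun o => decide (o = some j))
    (fun c => capped (KS j) (φS j).demand (successes c)), multilin]
  refine prodExp_congr (fun i b => ?_) _
  have hp : (∑ z, if i ∈ (successes fun i => decide (z i = some j)) then μ z else 0) =
      marginal μ i (some j) := by
    simp [successes, marginal]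
  have hsum := (sum_eq_one_of_mem_choiceHull (hq i)).2
  simp only [bern, hp]
  have ht : (∑ o, if decide (o = some j) = true then marginal μ i o else 0) =
      marginal μ i (some j) := by simp
  have hf : (∑ o, if decide (o = some j) = true then marginal μ i o else 0) +
      (∑ o, if decide (o = some j) = false then marginal μ i o else 0) = 1 := by
    rw [← Finset.sum_add_distrib, ← hsum]
    refine Finset.sum_congr rfl fun o _ => ?_
    by_cases h : o = some j <;> simp [h]
  cases b
  · simp only [Bool.false_eq_true, if_false]; linarith
  · simp only [if_true]; exact ht.symm

end Policy
end OneSided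

/-! ### Exchanging the two sides. -/

namespace Policy

section Swap

variable {C S : Type} [DecidableEq C] [DecidableEq S]

/-- The same policy with the roles of the two sides exchanged. -/
def swap : {R : Finset C} → {T : Finset S} → Policy C S R T → Policy S C T R
  | _, _, finish hR hT => finish hT hR
  | _, _, step A B hA hB showC showS next =>
      step B A hB hA showS showC fun d c => (next c d).swap
  | _, _, mix k w hw hsum next => mix k w hw hsum fun l => (next l).swap

theorem numMatches_swap [Fintype C] [Fintype S] (x : C → Option S) (y : S → Option C) :
    numMatches y x = numMatches x y := by
  unfold numMatches
  refine Finset.card_bij (fun p _ => (p.2, p.1)) ?_ ?_ ?_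
  · rintro ⟨j, i⟩ h
    simpa [and_comm] using h
  · rintro ⟨j, i⟩ _ ⟨j', i'⟩ _ e
    simp only [Prod.mk.injEq] at e ⊢
    exact ⟨e.2, e.1⟩
  · rintro ⟨i, j⟩ h
    exact ⟨(j, i), by simpa [and_comm] using h, rfl⟩

theorem expectedMatchesFrom_swap [Fintype C] [Fintype S] (φC : C → ChoiceModel S)
    (φS : S → ChoiceModel C) {R : Finset C} {T : Finset S} (π : Policy C S R T) :
    ∀ (x : C → Option S) (y : S → Option C),
      π.swap.expectedMatchesFrom φS φC y x = π.expectedMatchesFrom φC φS x y := by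
  induction π with
  | finish hR hT => intro x y; simp [swap, expectedMatchesFrom, numMatches_swap]
  | step A B hA hB showC showS next ih =>
    intro x y
    rw [swap, expectedMatchesFrom, expectedMatchesFrom, Finset.sum_comm]
    refine Finset.sum_congr rfl fun c _ => Finset.sum_congr rfl fun d _ => ?_
    rw [ih, mul_comm (∏ _, _)]
  | mix k w hw hsum next ih =>
    intro x y
    simp [swap, expectedMatchesFrom, ih]

theorem respectsCaps_swap (KC : C → ℕ∞) (KS : S → ℕ∞) {R : Finset C} {T : Finset S}
    (π : Policy C S R T) : π.swap.RespectsCaps KS KC ↔ π.RespectsCaps KC KS := by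
  induction π with
  | finish hR hT => simp [swap, RespectsCaps]
  | step A B hA hB showC showS next ih =>
    simp only [swap, RespectsCaps, ih]
    rw [and_left_comm, forall_comm]
  | mix k w hw hsum next ih => simp [swap, RespectsCaps, ih]

theorem showsChoosersOnly_swap {R : Finset C} {T : Finset S} (π : Policy C S R T) :
    ∀ (x : C → Option S) (y : S → Option C),
      π.swap.ShowsChoosersOnly y x ↔ π.ShowsChoosersOnly x y := by
  induction π with
  | finish hR hT => intro x y; simp [swap, ShowsChoosersOnly]
  | step A B hA hB showC showS next ih =>
    intro x y
    simp only [swap, ShowsChoosersOnly, ih]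
    rw [and_left_comm]
    exact and_congr_right fun _ => and_congr_right fun _ => forall_comm
  | mix k w hw hsum next ih => intro x y; simp [swap, ShowsChoosersOnly, ih]

theorem customersFirst_swap (t : Adaptivity) {R : Finset C} {T : Finset S} (π : Policy C S R T) :
    π.swap.CustomersFirst t.Batch ↔ π.SuppliersFirst t.Batch := by
  induction π with
  | finish hR hT => simp [swap, CustomersFirst, SuppliersFirst]
  | step A B hA hB showC showS next ih =>
    simp only [swap, CustomersFirst, SuppliersFirst, ih]
    rw [forall_comm]
  | mix k w hw hsum next ih => simp [swap, CustomersFirst, SuppliersFirst, ih]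

theorem suppliersFirst_swap (t : Adaptivity) {R : Finset C} {T : Finset S} (π : Policy C S R T) :
    π.swap.SuppliersFirst t.Batch ↔ π.CustomersFirst t.Batch := by
  induction π with
  | finish hR hT => simp [swap, CustomersFirst, SuppliersFirst]
  | step A B hA hB showC showS next ih =>
    simp only [swap, CustomersFirst, SuppliersFirst, ih]
    rw [forall_comm]
  | mix k w hw hsum next ih => simp [swap, CustomersFirst, SuppliersFirst, ih]

end Swap

theorem obeys_of_showsChoosersOnly {C S : Type} [DecidableEq C] [DecidableEq S] [Fintype C]
    [Fintype S] (rule : DisplayRule) {π : Policy C S Finset.univ Finset.univ}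
    (h : π.ShowsChoosersOnly (fun _ => none) (fun _ => none)) : π.Obeys rule := by
  cases rule
  · exact h
  · trivial

theorem Obeys.weaklySubstitutable_or {C S : Type} [DecidableEq C] [DecidableEq S] [Fintype C]
    [Fintype S] {rule : DisplayRule} {π : Policy C S Finset.univ Finset.univ}
    (h : π.Obeys rule) {p : Prop} (hp : rule = DisplayRule.anyAgents → p) :
    p ∨ π.ShowsChoosersOnly (fun _ => none) (fun _ => none) := by
  cases rule
  · exact Or.inr h
  · exact Or.inl (hp rfl)

end Policy

/-! ### Upper bounds on the adaptivity gap. -/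

namespace Setting

/-- The caps in force on the responding side. -/
def responseCaps {α : Type} (s : Setting) (K : α → ℕ∞) : α → ℕ∞ :=
  match s with
  | .twoWay => K
  | .oneWay => fun _ => ⊤

end Setting

namespace Instance

variable (I : Instance)

theorem mem_customerPolicies {s : Setting} {rule : DisplayRule} {t : Adaptivity} {π : I.Pol} :
    π ∈ I.customerPolicies s rule t ↔ π.CustomersFirst t.Batch ∧ π.Obeys rule ∧
      π.RespectsCaps I.KC (s.responseCaps I.KS) := by
  cases s <;> rfl

theorem mem_supplierPolicies {s : Setting} {rule : DisplayRule} {t : Adaptivity} {π : I.Pol} :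
    π ∈ I.supplierPolicies s rule t ↔ π.SuppliersFirst t.Batch ∧ π.Obeys rule ∧
      π.RespectsCaps (s.responseCaps I.KC) I.KS := by
  cases s <;> rfl

theorem le_OPT {s : Setting} {rule : DisplayRule} {t : Adaptivity} {π : I.Pol}
    (h : π ∈ I.customerPolicies s rule t ∪ I.supplierPolicies s rule t) :
    ENNReal.ofReal (π.expectedMatches I.customer I.supplier) ≤ I.OPT s rule t :=
  le_iSup₂ (f := fun (π : I.Pol) (_ : π ∈ I.customerPolicies s rule t ∪
    I.supplierPolicies s rule t) => ENNReal.ofReal (π.expectedMatches I.customer I.supplier)) π h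

theorem OPT_adaptive_le {α : ℝ} (hα0 : 0 < α) (s : Setting) (rule : DisplayRule)
    (hC : ∀ i, HasCorrelationGap α (capped (s.responseCaps I.KC i) (I.customer i).demand))
    (hS : ∀ j, HasCorrelationGap α (capped (s.responseCaps I.KS j) (I.supplier j).demand))
    (hsub : rule = DisplayRule.anyAgents → (∀ i, (I.customer i).WeaklySubstitutable) ∧
      ∀ j, (I.supplier j).WeaklySubstitutable) :
    I.OPT s rule Adaptivity.isAdaptive ≤
      ENNReal.ofReal α⁻¹ * I.OPT s rule Adaptivity.isStatic := by
  refine iSup₂_le fun π hπ => ?_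
  suffices ∃ π' ∈ I.customerPolicies s rule .isStatic ∪ I.supplierPolicies s rule .isStatic,
      α * π.expectedMatches I.customer I.supplier ≤ π'.expectedMatches I.customer I.supplier by
    obtain ⟨π', hπ', hle⟩ := this
    refine le_trans ?_ (mul_le_mul_right (I.le_OPT hπ') _)
    rw [← ENNReal.ofReal_mul (inv_nonneg.2 hα0.le)]
    refine ENNReal.ofReal_le_ofReal ?_
    rwa [inv_mul_eq_div, le_div_iff₀' hα0]
  rcases hπ with hπ | hπ
  · obtain ⟨h1, h2, h3⟩ := I.mem_customerPolicies.1 hπ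
    obtain ⟨π', h1', h2', h3', h4'⟩ := Policy.exists_static_ge I.customer I.supplier I.KC
      (s.responseCaps I.KS) α hS π h1 hα0.le h3 (h2.weaklySubstitutable_or fun h => (hsub h).2)
    exact ⟨π', Or.inl (I.mem_customerPolicies.2
      ⟨h1', Policy.obeys_of_showsChoosersOnly rule h3', h2'⟩), h4'⟩
  · obtain ⟨h1, h2, h3⟩ := I.mem_supplierPolicies.1 hπ
    obtain ⟨π', h1', h2', h3', h4'⟩ := Policy.exists_static_ge I.supplier I.customer I.KS
      (s.responseCaps I.KC) α hC π.swap ((Policy.customersFirst_swap _ π).2 h1) hα0.le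
      ((Policy.respectsCaps_swap _ _ π).2 h3)
      ((h2.weaklySubstitutable_or fun h => (hsub h).1).imp_right
        (Policy.showsChoosersOnly_swap π _ _).2)
    refine ⟨π'.swap, Or.inr (I.mem_supplierPolicies.2
      ⟨(Policy.suppliersFirst_swap _ π').2 h1',
        Policy.obeys_of_showsChoosersOnly rule ((Policy.showsChoosersOnly_swap π' _ _).2 h3'),
        (Policy.respectsCaps_swap _ _ π').2 h2'⟩), ?_⟩
    rw [Policy.expectedMatches, Policy.expectedMatchesFrom_swap] at h4'
    rw [Policy.expectedMatches, Policy.expectedMatches, Policy.expectedMatchesFrom_swap]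
    exact h4'

end Instance

theorem adaptivityGap_le {α : ℝ} (hα0 : 0 < α) (s : Setting) (rule : DisplayRule)
    (P : Instance → Prop)
    (hC : ∀ I, P I → ∀ i,
      HasCorrelationGap α (capped (s.responseCaps I.KC i) (I.customer i).demand))
    (hS : ∀ I, P I → ∀ j,
      HasCorrelationGap α (capped (s.responseCaps I.KS j) (I.supplier j).demand))
    (hsub : ∀ I, P I → rule = DisplayRule.anyAgents →
      (∀ i, (I.customer i).WeaklySubstitutable) ∧ ∀ j, (I.supplier j).WeaklySubstitutable) :
    adaptivityGap s rule P ≤ ENNReal.ofReal α⁻¹ :=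
  iSup₂_le fun I hI => ENNReal.div_le_of_le_mul
    (I.OPT_adaptive_le hα0 s rule (hC I hI) (hS I hI) (hsub I hI))

theorem one_sub_inv_exp_inv : (1 - (Real.exp 1)⁻¹)⁻¹ = Real.exp 1 / (Real.exp 1 - 1) := by
  have h := Real.add_one_lt_exp (one_ne_zero (α := ℝ))
  have h1 : Real.exp 1 - 1 ≠ 0 := by linarith
  have h2 : Real.exp 1 ≠ 0 := (Real.exp_pos 1).ne'
  field_simp

theorem one_sub_inv_exp_pos : 0 < 1 - (Real.exp 1)⁻¹ := by
  linarith [inv_exp_one_mem.2]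

theorem Instance.AllMNL.general {I : Instance} (h : I.AllMNL) (rule : DisplayRule) :
    I.General rule :=
  ⟨fun i => (h.1 i).monotoneSubmodular, fun j => (h.2 j).monotoneSubmodular,
    fun _ => ⟨fun i => (h.1 i).weaklySubstitutable, fun j => (h.2 j).weaklySubstitutable⟩⟩

theorem adaptivityGap_twoWay_general_le (rule : DisplayRule) :
    adaptivityGap Setting.twoWay rule (Instance.General rule) ≤
      ENNReal.ofReal ((Real.exp 1 / (Real.exp 1 - 1)) ^ 2) := by
  rw [← one_sub_inv_exp_inv, inv_pow]
  refine adaptivityGap_le (pow_pos one_sub_inv_exp_pos 2) _ _ _ (fun I hI i => ?_)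
    (fun I hI j => ?_) fun I hI h => hI.2.2 h
  · exact (hI.1 i).monoSubmod.capped_hasCorrelationGap (ChoiceModel.demand_empty _)
      (I.capC i).pos
  · exact (hI.2.1 j).monoSubmod.capped_hasCorrelationGap (ChoiceModel.demand_empty _)
      (I.capS j).pos

theorem adaptivityGap_twoWay_allMNL_le (rule : DisplayRule) :
    adaptivityGap Setting.twoWay rule Instance.AllMNL ≤
      ENNReal.ofReal (Real.exp 1 / (Real.exp 1 - 1)) := by
  rw [← one_sub_inv_exp_inv]
  refine adaptivityGap_le one_sub_inv_exp_pos _ _ _ (fun I hI i => ?_)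
    (fun I hI j => ?_) fun I hI h => (hI.general rule).2.2 h
  · exact ((hI.1 i).capped_monoSubmod _).hasCorrelationGap
      (capped_nonneg _ (ChoiceModel.demand_empty _).ge _)
  · exact ((hI.2 j).capped_monoSubmod _).hasCorrelationGap
      (capped_nonneg _ (ChoiceModel.demand_empty _).ge _)

theorem adaptivityGap_oneWay_general_le (rule : DisplayRule) :
    adaptivityGap Setting.oneWay rule (Instance.General rule) ≤
      ENNReal.ofReal (Real.exp 1 / (Real.exp 1 - 1)) := by
  rw [← one_sub_inv_exp_inv]
  refine adaptivityGap_le one_sub_inv_exp_pos _ _ _ (fun I hI i => ?_)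
    (fun I hI j => ?_) fun I hI h => hI.2.2 h
  · simp only [Setting.responseCaps, capped_top (hI.1 i).1]
    exact (hI.1 i).monoSubmod.hasCorrelationGap (ChoiceModel.demand_empty _).ge
  · simp only [Setting.responseCaps, capped_top (hI.2.1 j).1]
    exact (hI.2.1 j).monoSubmod.hasCorrelationGap (ChoiceModel.demand_empty _).ge

/-! ### Lower bound: the MNL instance and its policies. -/

section ProdExpMore

variable {ι α : Type} [Fintype ι] [DecidableEq ι] [Fintype α]

theorem prodExp_of_subsingleton [Subsingleton ι] (k : ι) (q : ι → α → ℝ)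
    (hq : ∀ i, ∑ a, q i a = 1) (h : (ι → α) → ℝ) :
    prodExp q h = ∑ a, q k a * h fun _ => a := by
  rw [prodExp_cond q k (hq k)]
  refine Finset.sum_congr rfl fun a _ => ?_
  have : ∀ c : ι → α, Function.update c k a = fun _ => a := fun c => by
    ext i; rw [Subsingleton.elim i k, Function.update_self]
  simp_rw [this]
  rw [prodExp_const q hq]

theorem prodExp_prod (q : ι → α → ℝ) (h : ι → α → ℝ) :
    prodExp q (fun c => ∏ i, h i (c i)) = ∏ i, ∑ a, q i a * h i a := by
  rw [Fintype.prod_sum]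
  exact Finset.sum_congr rfl fun c _ => (Finset.prod_mul_distrib).symm

end ProdExpMore

/-- The multinomial logit model in which all alternatives have the weight `v`. -/
def uniformMNL (β : Type) [DecidableEq β] (v : ℝ) (hv : 0 ≤ v) : ChoiceModel β where
  prob o E := match o with
    | none => 1 / (1 + E.card * v)
    | some b => if b ∈ E then v / (1 + E.card * v) else 0
  nonneg o E := by
    cases o
    · positivity
    · dsimp only; split_ifs <;> positivity
  eq_zero_of_notMem E b hb := by simp [hb]
  sum_eq_one E := by
    have : (0 : ℝ) < 1 + E.card * v := by positivity
    simp only [Finset.sum_ite_mem, Finset.inter_self, Finset.sum_const, nsmul_eq_mul]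
    field_simp

section UniformMNL

variable {β : Type} [DecidableEq β] {v : ℝ} (hv : 0 ≤ v)

theorem uniformMNL_isMNL : (uniformMNL β v hv).IsMNL :=
  ⟨fun _ => v, fun _ => hv, fun E => by simp +contextual [uniformMNL]⟩

theorem uniformMNL_prob_none_singleton (b : β) :
    (uniformMNL β v hv).prob none {b} = 1 - v / (1 + v) := by
  have : 1 + v ≠ 0 := by positivity
  simp only [uniformMNL, Finset.card_singleton, Nat.cast_one, one_mul]
  field_simp
  ring

theorem uniformMNL_prob_some_singleton (b : β) :
    (uniformMNL β v hv).prob (some b) {b} = v / (1 + v) := by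
  simp [uniformMNL]

theorem uniformMNL_prob_some_le (b : β) (E : Finset β) :
    (uniformMNL β v hv).prob (some b) E ≤ if b ∈ E then v / (1 + v) else 0 := by
  simp only [uniformMNL]
  split_ifs with h
  · have : (1 : ℝ) ≤ E.card := by exact_mod_cast Finset.card_pos.2 ⟨b, h⟩
    gcongr
    nlinarith
  · exact le_rfl

theorem uniformMNL_demand_le (E : Finset β) : (uniformMNL β v hv).demand E ≤ E.card * v := by
  rw [ChoiceModel.demand, ← nsmul_eq_mul, ← Finset.sum_const]
  refine Finset.sum_le_sum fun b hb => (uniformMNL_prob_some_le hv b E).trans ?_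
  rw [if_pos hb]
  exact div_le_self hv (by linarith)

theorem ChoiceModel.demand_le_one (φ : ChoiceModel β) (E : Finset β) : φ.demand E ≤ 1 := by
  have := φ.sum_eq_one E
  have := φ.nonneg none E
  unfold demand
  linarith

end UniformMNL

section LowerBound

variable {C S : Type} [Fintype C] [Fintype S] [DecidableEq C] [DecidableEq S]

/-- The suppliers chosen by at least one customer. -/
def chosen (x : C → Option S) : Finset S :=
  Finset.univ.filter fun j => ∃ i, x i = some j

/-- A supplier displayed to d customers is missed by all with probability at least (1 - p)^d. This
is convex in d and the d's sum to at most |S| N, so the equal split d = N maximizes the bound. -/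
theorem staticValue_uniformMNL_le (φS : S → ChoiceModel C) {v : ℝ} (hv : 0 ≤ v) (KS : S → ℕ∞)
    (N : ℕ) (hC : Fintype.card C = Fintype.card S * N) (E : C → Finset S)
    (hE : ∀ i, (E i).card ≤ 1) :
    staticValue (fun _ => uniformMNL S v hv) φS KS E ≤
      Fintype.card S * (1 - (1 - v / (1 + v)) ^ N) := by
  set p := v / (1 + v) with hp
  have hp0 : 0 ≤ p := by positivity
  have hr : 1 - p = 1 / (1 + v) := by rw [hp]; field_simp; ring
  have hr0 : 0 < 1 - p := by rw [hr]; positivity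
  set q : C → Option S → ℝ := fun i o => (uniformMNL S v hv).prob o (E i) with hq
  have hq1 : ∀ i, ∑ o, q i o = 1 := fun i => (uniformMNL S v hv).sum_prob _
  set d : S → ℕ := fun j => (Finset.univ.filter fun i => j ∈ E i).card with hd
  have hpoint : ∀ z : C → Option S, responseValue φS KS z ≤
      ∑ j, (1 - ∏ i, if z i = some j then (0 : ℝ) else 1) := by
    intro z
    refine Finset.sum_le_sum fun j _ => ?_
    obtain ⟨F, hF, -, e⟩ := exists_capped (KS j) (φS j).demand (choosers z j)
    rw [e]
    rcases (choosers z j).eq_empty_or_nonempty with h0 | ⟨i, hi⟩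
    · rw [h0, Finset.subset_empty] at hF
      rw [hF, ChoiceModel.demand_empty, Finset.prod_eq_one]
      · simp
      · intro i _
        refine if_neg fun h => ?_
        have : i ∈ choosers z j := by simp [choosers, h]
        simp [h0] at this
    · have hz : (∏ i, if z i = some j then (0 : ℝ) else 1) = 0 :=
        Finset.prod_eq_zero (Finset.mem_univ i) (if_pos (by simpa [choosers] using hi))
      rw [hz, sub_zero]
      exact ChoiceModel.demand_le_one _ _
  have hprod : ∀ j, (1 - p) ^ d j ≤ ∏ i, ∑ o, q i o * (if o = some j then (0 : ℝ) else 1) := by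
    intro j
    have e : (1 - p) ^ d j = ∏ i, if j ∈ E i then 1 - p else 1 := by
      rw [Finset.prod_ite, Finset.prod_const, Finset.prod_const_one, mul_one]
    rw [e]
    refine Finset.prod_le_prod (fun i _ => by split_ifs <;> linarith) fun i _ => ?_
    have h1 : ∑ o, q i o * (if o = some j then (0 : ℝ) else 1) = 1 - q i (some j) := by
      rw [eq_sub_iff_add_eq]
      have : q i (some j) = ∑ o, q i o * (if o = some j then (1 : ℝ) else 0) := by simp
      rw [this, ← Finset.sum_add_distrib]
      refine (Finset.sum_congr rfl fun o _ => ?_).trans (hq1 i)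
      split_ifs <;> simp
    rw [h1]
    have := uniformMNL_prob_some_le hv j (E i)
    rw [← hp] at this
    simp only [hq]
    split_ifs with h
    · rw [if_pos h] at this; linarith
    · rw [if_neg h] at this; linarith
  have hdsum : ∑ j, (d j : ℝ) ≤ Fintype.card S * N := by
    have : ∑ j, d j = ∑ i, (E i).card := by
      simp only [hd, Finset.card_filter]
      rw [Finset.sum_comm]
      simp
    have h2 : ∑ i, (E i).card ≤ Fintype.card S * N := by
      rw [← hC]
      calc ∑ i, (E i).card ≤ ∑ _i : C, 1 := Finset.sum_le_sum fun i _ => hE i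
        _ = Fintype.card C := by simp
    rw [← this] at h2
    exact_mod_cast h2
  -- The tangent at N of the convex function k ↦ (1 - p)^k.
  have hpow : ∀ k : ℕ, (1 - p) ^ N * (1 + ((k : ℝ) - N) * Real.log (1 - p)) ≤ (1 - p) ^ k := by
    intro k
    have h1 := Real.add_one_le_exp (((k : ℝ) - N) * Real.log (1 - p))
    have h2 : ∀ n : ℕ, (1 - p) ^ n = Real.exp (n * Real.log (1 - p)) := fun n => by
      rw [Real.exp_nat_mul, Real.exp_log hr0]
    rw [h2 k, h2 N]
    calc _ ≤ Real.exp (N * Real.log (1 - p)) * Real.exp (((k : ℝ) - N) * Real.log (1 - p)) :=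
          mul_le_mul_of_nonneg_left (by linarith) (Real.exp_pos _).le
      _ = _ := by rw [← Real.exp_add]; congr 1; ring
  have hsum : Fintype.card S * (1 - p) ^ N ≤ ∑ j, (1 - p) ^ d j := by
    refine le_trans ?_ (Finset.sum_le_sum fun j _ => hpow (d j))
    rw [← Finset.mul_sum, Finset.sum_add_distrib, ← Finset.sum_mul, Finset.sum_sub_distrib]
    simp only [Finset.sum_const, Finset.card_univ, nsmul_eq_mul, mul_one]
    have hlog : Real.log (1 - p) ≤ 0 := Real.log_nonpos hr0.le (by linarith)
    have : 0 ≤ (1 - p) ^ N := by positivity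
    have h3 : 0 ≤ (∑ j, (d j : ℝ) - Fintype.card S * N) * Real.log (1 - p) :=
      mul_nonneg_of_nonpos_of_nonpos (by linarith) hlog
    nlinarith
  rw [staticValue]
  refine (prodExp_mono (fun _ _ => ChoiceModel.nonneg _ _ _) hpoint).trans ?_
  rw [prodExp_sum]
  have e : ∀ j, prodExp q (fun z => 1 - ∏ i, if z i = some j then (0 : ℝ) else 1) =
      1 - ∏ i, ∑ o, q i o * (if o = some j then (0 : ℝ) else 1) := by
    intro j
    rw [prodExp_sub, prodExp_const q hq1,
      prodExp_prod q (fun _ o => if o = some j then (0 : ℝ) else 1)]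
  rw [Finset.sum_congr rfl fun j _ => e j, Finset.sum_sub_distrib]
  have := Finset.sum_le_sum fun j (_ : j ∈ Finset.univ) => hprod j
  simp only [Finset.sum_const, Finset.card_univ, nsmul_eq_mul, mul_one]
  linarith

/-- Every customer belongs to the choosers of at most one supplier and adds at most `w` there. With
the sides exchanged, this disposes of policies in which the suppliers initiate. -/
theorem responseValue_uniformMNL_le {w : ℝ} (hw : 0 ≤ w) (KS : S → ℕ∞) (x : C → Option S) :
    responseValue (fun _ => uniformMNL C w hw) KS x ≤ Fintype.card C * w := by
  have h1 : ∀ j, capped (KS j) (uniformMNL C w hw).demand (choosers x j) ≤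
      (choosers x j).card * w := by
    intro j
    obtain ⟨F, hF, -, e⟩ := exists_capped (KS j) (uniformMNL C w hw).demand (choosers x j)
    rw [e]
    refine (uniformMNL_demand_le hw F).trans (mul_le_mul_of_nonneg_right ?_ hw)
    exact_mod_cast Finset.card_le_card hF
  refine (Finset.sum_le_sum fun j _ => h1 j).trans ?_
  rw [← Finset.sum_mul]
  refine mul_le_mul_of_nonneg_right ?_ hw
  have : ∑ j, (choosers x j).card ≤ Fintype.card C := by
    rw [← Finset.card_biUnion]
    · exact Finset.card_le_univ _
    · intro j _ j' _ hne
      refine Finset.disjoint_left.2 fun i hi hi' => hne ?_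
      simp only [choosers, Finset.mem_filter, Finset.mem_univ, true_and] at hi hi'
      simpa [hi] using hi'
  exact_mod_cast this

theorem le_responseValue_uniformMNL {w : ℝ} (hw : 0 ≤ w) (KS : S → ℕ∞) (hK : ∀ j, 1 ≤ KS j)
    (x : C → Option S) :
    w / (1 + w) * (chosen x).card ≤ responseValue (fun _ => uniformMNL C w hw) KS x := by
  have h0 : ∀ j, 0 ≤ capped (KS j) (uniformMNL C w hw).demand (choosers x j) := fun j =>
    capped_nonneg _ (ChoiceModel.demand_empty _).ge _
  rw [mul_comm, ← nsmul_eq_mul, ← Finset.sum_const]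
  refine le_trans (Finset.sum_le_sum fun j hj => ?_)
    (Finset.sum_le_sum_of_subset_of_nonneg (Finset.subset_univ (chosen x)) fun j _ _ => h0 j)
  obtain ⟨i, hi⟩ := (Finset.mem_filter.1 hj).2
  refine le_trans ?_ (le_capped _ (T := {i}) (by simp [choosers, hi]) (by simpa using hK j))
  simp [ChoiceModel.demand, uniformMNL_prob_some_singleton]

/-- A lower bound for the expected value of `min (b + B) m`, where `B` is binomial with parameters
`r` and `p`. -/
def truncatedBound (p m a : ℝ) (r b : ℝ) : ℝ :=
  b + r * p - ((b + r * p - m + a) ^ 2 + r * p) / (4 * a)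

/-- For a > 0 one has max(u - m, 0) ≤ (u - m + a)² / (4a), hence min(u, m) ≥ u - (u - m + a)² /
(4a). `truncatedBound` is the expectation of the right-hand side at u = b + B, with the variance of
B raised from rp(1 - p) to rp. This lemma and the next two give its boundary values and recursion.
-/
theorem truncatedBound_zero_le {p m a : ℝ} (ha : 0 < a) (b : ℝ) :
    truncatedBound p m a 0 b ≤ b := by
  have : 0 ≤ ((b + 0 * p - m + a) ^ 2 + 0 * p) / (4 * a) := by
    rw [zero_mul]; positivity
  unfold truncatedBound
  linarith

theorem truncatedBound_self_le {p m a : ℝ} (ha : 0 < a) (hp : 0 ≤ p) {r : ℝ} (hr : 0 ≤ r) :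
    truncatedBound p m a r m ≤ m := by
  have : r * p ≤ ((m + r * p - m + a) ^ 2 + r * p) / (4 * a) := by
    rw [le_div_iff₀ (by positivity)]
    nlinarith [sq_nonneg (r * p - a), mul_nonneg hr hp]
  unfold truncatedBound
  linarith

theorem truncatedBound_succ_le {p m a : ℝ} (ha : 0 < a) (r b : ℝ) :
    truncatedBound p m a (r + 1) b ≤
      (1 - p) * truncatedBound p m a r b + p * truncatedBound p m a r (b + 1) := by
  have : (1 - p) * truncatedBound p m a r b + p * truncatedBound p m a r (b + 1) -
      truncatedBound p m a (r + 1) b = p ^ 2 / (4 * a) := by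
    unfold truncatedBound
    field_simp
    ring
  have : 0 ≤ p ^ 2 / (4 * a) := by positivity
  linarith

/-- The policy displays a supplier that nobody has chosen yet, as long as there is one. As
unprocessed customers have the choice `none`, a success enlarges `chosen x` by one. The first of the
two bounds is carried along for the case where all suppliers have been chosen. -/
theorem exists_adaptive_ge {v w a : ℝ} (hv : 0 ≤ v) (hw : 0 ≤ w) (ha : 0 < a) (KC : C → ℕ∞)
    (KS : S → ℕ∞) (hKC : ∀ i, 1 ≤ KC i) (hKS : ∀ j, 1 ≤ KS j) (r : ℕ) :
    ∀ (R : Finset C) (T : Finset S) (x : C → Option S) (y : S → Option C), R.card = r →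
      T = Finset.univ → (∀ i ∈ R, x i = none) →
      ∃ π : Policy C S R T, π.CustomersFirst Adaptivity.isAdaptive.Batch ∧
        π.RespectsCaps KC KS ∧ π.ShowsChoosersOnly x y ∧
        w / (1 + w) * (chosen x).card ≤ π.expectedMatchesFrom (fun _ => uniformMNL S v hv)
          (fun _ => uniformMNL C w hw) x y ∧
        w / (1 + w) * truncatedBound (v / (1 + v)) (Fintype.card S) a r (chosen x).card ≤
          π.expectedMatchesFrom (fun _ => uniformMNL S v hv) (fun _ => uniformMNL C w hw) x y := by
  have hρ : 0 ≤ w / (1 + w) := by positivity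
  set p := v / (1 + v) with hp
  have hp0 : 0 ≤ p := by positivity
  have hp1 : p ≤ 1 := div_le_one_of_le₀ (by linarith) (by linarith)
  induction r with
  | zero =>
    intro R T x y hR hT _
    obtain ⟨π, h1, h2, h3, h4⟩ := Policy.exists_responseValue (fun _ => uniformMNL S v hv)
      (fun _ => uniformMNL C w hw) KC KS .isAdaptive (Finset.card_eq_zero.1 hR) hT x y
    have h5 := le_responseValue_uniformMNL hw KS hKS x
    refine ⟨π, h1, h2, h3, h4 ▸ h5, h4 ▸ le_trans ?_ h5⟩
    rw [Nat.cast_zero]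
    exact mul_le_mul_of_nonneg_left (truncatedBound_zero_le ha _) hρ
  | succ r ih =>
    intro R T x y hR hT hx
    subst hT
    obtain ⟨i, hi⟩ : R.Nonempty := Finset.card_pos.1 (by omega)
    have hxi := hx i hi
    have := fun (c : ↥({i} : Finset C) → Option S) (d : ↥(∅ : Finset S) → Option C) =>
      ih (R \ {i}) (Finset.univ \ ∅) (updateChoices x {i} c) (updateChoices y ∅ d)
        (by rw [Finset.sdiff_singleton_eq_erase, Finset.card_erase_of_mem hi]; omega) (by simp)
        (fun i' hi' => by
          rw [Finset.mem_sdiff] at hi'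
          rw [updateChoices_of_notMem x c hi'.2]
          exact hx i' hi'.1)
    choose next h1 h2 h3 h4 h5 using this
    have build : ∀ E : Finset S, E.card ≤ 1 → ∃ π : Policy C S R Finset.univ,
        π.CustomersFirst Adaptivity.isAdaptive.Batch ∧ π.RespectsCaps KC KS ∧
        π.ShowsChoosersOnly x y ∧
        π.expectedMatchesFrom (fun _ => uniformMNL S v hv) (fun _ => uniformMNL C w hw) x y =
          ∑ o, (uniformMNL S v hv).prob o E *
            (next (fun _ => o) fun _ => none).expectedMatchesFrom (fun _ => uniformMNL S v hv)
              (fun _ => uniformMNL C w hw) (updateChoices x {i} fun _ => o)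
              (updateChoices y ∅ fun _ => none) := by
      intro E hE
      refine ⟨Policy.step {i} ∅ (Finset.singleton_subset_iff.2 hi) (Finset.empty_subset _)
        (fun _ => E) (fun _ => ∅) next, ?_, ?_, ?_, ?_⟩
      · rw [Policy.CustomersFirst]
        exact ⟨fun _ => ⟨Finset.card_singleton i, rfl⟩, h1⟩
      · rw [Policy.RespectsCaps]
        exact ⟨fun i => le_trans (by exact_mod_cast hE) (hKC i),
          fun j => absurd j.2 (Finset.notMem_empty _), h2⟩
      · rw [Policy.ShowsChoosersOnly]
        refine ⟨fun _ j => absurd j.2 (Finset.notMem_empty _), fun hT _ j => ?_, h3⟩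
        exact absurd (hT ▸ Finset.mem_univ j) (Finset.notMem_empty _)
      · rw [Policy.expectedMatchesFrom_step,
          prodExp_of_subsingleton ⟨i, Finset.mem_singleton_self i⟩ _
            fun _ => ChoiceModel.sum_prob _ _]
        refine Finset.sum_congr rfl fun o _ => ?_
        rw [prodExp_of_isEmpty _ _ fun _ => none]
    set V : Option S → ℝ := fun o =>
      (next (fun _ => o) fun _ => none).expectedMatchesFrom (fun _ => uniformMNL S v hv)
        (fun _ => uniformMNL C w hw) (updateChoices x {i} fun _ => o)
        (updateChoices y ∅ fun _ => none) with hV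
    have hup : ∀ o i', updateChoices x {i} (fun _ => o) i' = if i' = i then o else x i' := by
      intro o i'; simp [updateChoices]
    have hnone : chosen (updateChoices x {i} fun _ => none) = chosen x := by
      have : (updateChoices x {i} fun _ => none) = x := by
        funext i'; rw [hup]; split_ifs with h
        · rw [h, hxi]
        · rfl
      rw [this]
    have hVn1 : w / (1 + w) * (chosen x).card ≤ V none := by
      have := h4 (fun _ => none) (fun _ => none); rwa [hnone] at this
    have hVn2 : w / (1 + w) * truncatedBound p (Fintype.card S) a r (chosen x).card ≤ V none := by
      have := h5 (fun _ => none) (fun _ => none); rwa [hnone] at this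
    by_cases hall : ∃ j, j ∉ chosen x
    · obtain ⟨j, hj⟩ := hall
      have hsome : (chosen (updateChoices x {i} fun _ => some j)).card = (chosen x).card + 1 := by
        rw [← Finset.card_insert_of_notMem hj]
        congr 1
        ext j'
        simp only [chosen, Finset.mem_filter, Finset.mem_univ, true_and, Finset.mem_insert, hup]
        constructor
        · rintro ⟨i', h⟩
          split_ifs at h with hi'
          · exact Or.inl (Option.some.inj h).symm
          · exact Or.inr ⟨i', h⟩
        · rintro (rfl | ⟨i', h⟩)
          · exact ⟨i, by simp⟩
          · refine ⟨i', ?_⟩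
            rw [if_neg, h]
            rintro rfl
            simp [hxi] at h
      have hVs1 : w / (1 + w) * ((chosen x).card + 1) ≤ V (some j) := by
        have := h4 (fun _ => some j) (fun _ => none)
        rw [hsome] at this
        exact_mod_cast this
      have hVs2 : w / (1 + w) * truncatedBound p (Fintype.card S) a r ((chosen x).card + 1) ≤
          V (some j) := by
        have := h5 (fun _ => some j) (fun _ => none)
        rw [hsome] at this
        exact_mod_cast this
      obtain ⟨π, g1, g2, g3, g4⟩ := build {j} (by simp)
      have e : ∑ o, (uniformMNL S v hv).prob o {j} * V o = (1 - p) * V none + p * V (some j) := by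
        rw [ChoiceModel.sum_option, Finset.sum_singleton, uniformMNL_prob_none_singleton,
          uniformMNL_prob_some_singleton]
      rw [e] at g4
      refine ⟨π, g1, g2, g3, ?_, ?_⟩ <;> rw [g4]
      · have := mul_le_mul_of_nonneg_left hVn1 (sub_nonneg.2 hp1)
        have := mul_le_mul_of_nonneg_left hVs1 hp0
        have := mul_nonneg hp0 hρ
        nlinarith
      · have h6 := mul_le_mul_of_nonneg_left hVn2 (sub_nonneg.2 hp1)
        have h7 := mul_le_mul_of_nonneg_left hVs2 hp0
        have h8 := mul_le_mul_of_nonneg_left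
          (truncatedBound_succ_le (p := p) (m := Fintype.card S) ha r (chosen x).card) hρ
        push_cast
        linarith
    -- Nothing is left to gain: the customer is shown the empty assortment, and the first bound
    -- dominates the second.
    · push Not at hall
      have hcard : (chosen x).card = Fintype.card S := by
        rw [Finset.eq_univ_iff_forall.2 hall, Finset.card_univ]
      obtain ⟨π, g1, g2, g3, g4⟩ := build ∅ (by simp)
      have e : ∑ o, (uniformMNL S v hv).prob o ∅ * V o = V none := by
        rw [ChoiceModel.sum_option]
        simp [uniformMNL]
      rw [e] at g4
      refine ⟨π, g1, g2, g3, ?_, ?_⟩ <;> rw [g4]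
      · exact hVn1
      · refine le_trans (mul_le_mul_of_nonneg_left ?_ hρ) hVn1
        rw [hcard]
        exact truncatedBound_self_le ha hp0 (by positivity)

end LowerBound

/-- Customers who hardly ever choose the single supplier displayed to them, and suppliers who almost
surely accept a customer. -/
def gapInstance (k : ℕ) : Instance where
  n := k ^ 2 * (k + 2)
  m := k ^ 2
  customer _ := uniformMNL _ (1 / (k + 1)) (by positivity)
  supplier _ := uniformMNL _ k (by positivity)
  capC _ := 1
  capS _ := 1

theorem gapInstance_allMNL (k : ℕ) : (gapInstance k).AllMNL :=
  ⟨fun _ => uniformMNL_isMNL (by positivity), fun _ => uniformMNL_isMNL (by positivity)⟩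

/-- Upper bound for the expected share of suppliers matched by static policies. -/
def staticShare (k : ℕ) : ℝ := max (1 - (1 - 1 / ((k : ℝ) + 2)) ^ (k + 2)) (1 / (k + 1))

/-- With success probability 1/(k+2), the k + 2 customers per supplier produce one success per
supplier on average. -/
theorem gapInstance_prob (k : ℕ) : (1 / ((k : ℝ) + 1)) / (1 + 1 / (k + 1)) = 1 / (k + 2) := by
  have : (k : ℝ) + 1 ≠ 0 := by positivity
  have : (k : ℝ) + 2 ≠ 0 := by positivity
  have : 1 + 1 / ((k : ℝ) + 1) = (k + 2) / (k + 1) := by field_simp; ring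
  rw [this]
  field_simp

theorem responseCaps_one_le {α : Type} (s : Setting) {K : α → ℕ∞} (h : ∀ a, 1 ≤ K a) (a : α) :
    1 ≤ s.responseCaps K a := by
  cases s
  · exact h a
  · exact le_top

theorem gapInstance_OPT_static_le (k : ℕ) (s : Setting) (rule : DisplayRule) :
    (gapInstance k).OPT s rule Adaptivity.isStatic ≤
      ENNReal.ofReal ((k : ℝ) ^ 2 * staticShare k) := by
  -- MNL models are weakly substitutable, so the bound for arbitrary displays covers both rules.
  have hgen := (gapInstance_allMNL k).general .anyAgents
  refine iSup₂_le fun π hπ => ENNReal.ofReal_le_ofReal ?_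
  rcases hπ with hπ | hπ
  · obtain ⟨h1, h2, h3⟩ := (gapInstance k).mem_customerPolicies.1 hπ
    refine Policy.static_le _ _ _ _ _ (fun E hE => ?_) π _ _ rfl rfl h1 h3
      (Or.inl (hgen.2.2 rfl).2)
    have h := staticValue_uniformMNL_le (C := Fin (k ^ 2 * (k + 2))) (S := Fin (k ^ 2))
      (gapInstance k).supplier (v := 1 / ((k : ℝ) + 1)) (by positivity)
      (s.responseCaps (gapInstance k).KS) (k + 2) (by simp) E
      (fun i => by simpa [Instance.KC, gapInstance] using hE i)
    rw [gapInstance_prob, Fintype.card_fin] at h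
    refine h.trans ?_
    push_cast
    exact mul_le_mul_of_nonneg_left (le_max_left _ _) (by positivity)
  · obtain ⟨h1, h2, h3⟩ := (gapInstance k).mem_supplierPolicies.1 hπ
    rw [Policy.expectedMatches, ← Policy.expectedMatchesFrom_swap]
    refine Policy.static_le _ _ _ _ _ (fun E hE => ?_) π.swap _ _ rfl rfl
      ((Policy.customersFirst_swap _ π).2 h1) ((Policy.respectsCaps_swap _ _ π).2 h3)
      (Or.inl (hgen.2.2 rfl).1)
    rw [staticValue]
    have h := responseValue_uniformMNL_le (S := Fin (k ^ 2 * (k + 2))) (C := Fin (k ^ 2))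
      (w := 1 / ((k : ℝ) + 1)) (by positivity) (s.responseCaps (gapInstance k).KC)
    refine (prodExp_mono (fun _ _ => ChoiceModel.nonneg _ _ _) h).trans
      ((prodExp_const _ (fun _ => ChoiceModel.sum_prob _ _) _).trans_le ?_)
    rw [Fintype.card_fin]
    push_cast
    exact mul_le_mul_of_nonneg_left (le_max_right _ _) (by positivity)

theorem le_gapInstance_OPT_adaptive {k : ℕ} (hk : 0 < k) (s : Setting) (rule : DisplayRule) :
    ENNReal.ofReal ((k : ℝ) ^ 2 * (k / (1 + k) * (1 - 1 / (2 * k)))) ≤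
      (gapInstance k).OPT s rule Adaptivity.isAdaptive := by
  have hk' : (0 : ℝ) < k := by exact_mod_cast hk
  -- The choice a = k balances a² against the variance bound k², leaving an expected loss of k/2 out
  -- of k² suppliers.
  obtain ⟨π, h1, h2, h3, -, h5⟩ := exists_adaptive_ge (C := Fin (k ^ 2 * (k + 2)))
    (S := Fin (k ^ 2)) (v := 1 / ((k : ℝ) + 1)) (w := k) (a := k) (by positivity) hk'.le hk'
    (gapInstance k).KC (s.responseCaps (gapInstance k).KS)
    (fun i => by simp [Instance.KC, gapInstance])
    (responseCaps_one_le s fun j => by simp [Instance.KS, gapInstance]) (k ^ 2 * (k + 2))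
    Finset.univ Finset.univ (fun _ => none) (fun _ => none) (by simp) rfl (fun _ _ => rfl)
  refine le_trans (ENNReal.ofReal_le_ofReal ?_) ((gapInstance k).le_OPT (π := π) (Or.inl
    ((gapInstance k).mem_customerPolicies.2
      ⟨h1, Policy.obeys_of_showsChoosersOnly rule h3, h2⟩)))
  refine le_trans (le_of_eq ?_) h5
  rw [gapInstance_prob]
  have hc : (chosen fun _ : Fin (k ^ 2 * (k + 2)) => (none : Option (Fin (k ^ 2)))) = ∅ := by
    simp [chosen]
  rw [hc, Fintype.card_fin, Finset.card_empty, truncatedBound]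
  push_cast
  have : (k : ℝ) + 2 ≠ 0 := by positivity
  field_simp
  ring

/-- Per supplier, the adaptive value tends to 1 and `staticShare` to 1 - 1/e, the term 1/(k+1) in
its maximum being negligible. -/
theorem le_adaptivityGap_of_allMNL (s : Setting) (rule : DisplayRule) {P : Instance → Prop}
    (hP : ∀ I : Instance, I.AllMNL → P I) :
    ENNReal.ofReal (Real.exp 1 / (Real.exp 1 - 1)) ≤ adaptivityGap s rule P := by
  have hlim : Filter.Tendsto
      (fun k : ℕ => ENNReal.ofReal ((k / (1 + k) * (1 - 1 / (2 * k))) / staticShare k))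
      Filter.atTop (nhds (ENNReal.ofReal (Real.exp 1 / (Real.exp 1 - 1)))) := by
    refine ENNReal.tendsto_ofReal ?_
    have t0 : Filter.Tendsto (fun k : ℕ => 1 / ((k : ℝ) + 1)) Filter.atTop (nhds 0) :=
      tendsto_one_div_add_atTop_nhds_zero_nat
    have t1 : Filter.Tendsto (fun k : ℕ => (k : ℝ) / (1 + k)) Filter.atTop (nhds 1) := by
      have := t0.const_sub 1
      rw [sub_zero] at this
      refine this.congr fun k => ?_
      have : (k : ℝ) + 1 ≠ 0 := by positivity
      rw [add_comm (1 : ℝ)]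
      field_simp
      ring
    have t2 : Filter.Tendsto (fun k : ℕ => 1 - 1 / (2 * (k : ℝ))) Filter.atTop (nhds 1) := by
      have := ((tendsto_one_div_atTop_nhds_zero_nat (𝕜 := ℝ)).const_mul (1 / 2)).const_sub 1
      rw [mul_zero, sub_zero] at this
      refine this.congr fun k => ?_
      rw [one_div_mul_one_div]
    have t3 : Filter.Tendsto (fun k : ℕ => (1 - 1 / ((k : ℝ) + 2)) ^ (k + 2)) Filter.atTop
        (nhds (Real.exp 1)⁻¹) := by
      have := (Real.tendsto_one_add_div_pow_exp (-1)).comp (Filter.tendsto_add_atTop_nat 2)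
      rw [Real.exp_neg] at this
      refine this.congr fun k => ?_
      simp only [Function.comp_apply]
      push_cast
      congr 1
      ring
    have t4 : Filter.Tendsto staticShare Filter.atTop (nhds (1 - (Real.exp 1)⁻¹)) := by
      have := (t3.const_sub 1).max t0
      rwa [max_eq_left one_sub_inv_exp_pos.le] at this
    have := (t1.mul t2).div t4 one_sub_inv_exp_pos.ne'
    rwa [one_mul, one_div, one_sub_inv_exp_inv] at this
  refine le_of_tendsto hlim (Filter.eventually_atTop.2 ⟨1, fun k hk => ?_⟩)
  have hk' : (0 : ℝ) < k := by exact_mod_cast hk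
  have hshare : 0 < staticShare k := lt_max_of_lt_right (by positivity)
  have hratio : (gapInstance k).OPT s rule Adaptivity.isAdaptive /
      (gapInstance k).OPT s rule Adaptivity.isStatic ≤ adaptivityGap s rule P :=
    le_iSup₂ (f := fun (I : Instance) (_ : P I) => I.OPT s rule Adaptivity.isAdaptive /
      I.OPT s rule Adaptivity.isStatic) (gapInstance k) (hP _ (gapInstance_allMNL k))
  refine le_trans ?_ hratio
  rw [← mul_div_mul_left _ _ (pow_pos hk' 2).ne', ENNReal.ofReal_div_of_pos (by positivity)]
  exact ENNReal.div_le_div (le_gapInstance_OPT_adaptive hk s rule)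
    (gapInstance_OPT_static_le k s rule)

theorem theorem7 (rule : DisplayRule) :
    (ENNReal.ofReal (Real.exp 1 / (Real.exp 1 - 1)) ≤
        adaptivityGap Setting.twoWay rule (Instance.General rule) ∧
      adaptivityGap Setting.twoWay rule (Instance.General rule) ≤
        ENNReal.ofReal ((Real.exp 1 / (Real.exp 1 - 1)) ^ 2)) ∧
    adaptivityGap Setting.twoWay rule Instance.AllMNL =
      ENNReal.ofReal (Real.exp 1 / (Real.exp 1 - 1)) ∧
    adaptivityGap Setting.oneWay rule (Instance.General rule) =
      ENNReal.ofReal (Real.exp 1 / (Real.exp 1 - 1)) :=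
  ⟨⟨le_adaptivityGap_of_allMNL _ rule fun _ h => h.general rule,
      adaptivityGap_twoWay_general_le rule⟩,
    le_antisymm (adaptivityGap_twoWay_allMNL_le rule)
      (le_adaptivityGap_of_allMNL _ rule fun _ h => h),
    le_antisymm (adaptivityGap_oneWay_general_le rule)
      (le_adaptivityGap_of_allMNL _ rule fun _ h => h.general rule)⟩

end
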